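/- Let $d\ge 2$ and let $m(\mathbf x)=c+\sum_{\alpha=1}^d m_\alpha(x_\alpha)$. Let $(\mathbf X_i,\varepsilon_i)_{i\ge1}$ be a process of random vectors $\mathbf X_i=(X_{i1},\dots,X_{id})$ and real random variables $\varepsilon_i$, where the $\mathbf X_i$ share a common law and $E\,m_\alpha(X_{i\alpha})=0$ for all $\alpha$. Assume: (A1) $m_1\in C^{(2)}[0,1]$, and for some constant $C>0$, $|m_\beta(x)-m_\beta(x')|\le C|x-x'|$ for all $x,x'\in[0,1]$ and $\beta=2,\dots,d$. (A2) With $\mathbf Z_i=(\mathbf X_i,\varepsilon_i)$ and $\alpha(k)=\sup|P(B\cap C)-P(B)P(C)|$, the supremum being over all $t$, all $B\in\sigma(\mathbf Z_s,s\le t)$ and all $C\in\sigma(\mathbf Z_s,s\ge t+k)$, there are $K_0,\lambda_0>0$ such that $\alpha(k)\le K_0e^{-\lambda_0k}$ for all $k\ge1$. (A4) $\mathbf X_i$ takes values in $[0,1]^d$ and has there a continuous density $f$ with $0<c_f\le f\le C_f<\infty$; its marginal densities $f_\alpha$ are continuously differentiable on $[0,1]$ with $c_f\le f_\alpha\le C_f$.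 (A5) $K$ is Lipschitz continuous on $[-1,1]$, bounded, nonnegative, symmetric, and zero outside $[-1,1]$; the bandwidth $h=h_n$ satisfies $c_hn^{-1/5}\le h\le C_hn^{-1/5}$ for all large $n$, with constants $c_h,C_h>0$. Write $K_h(u)=K(u/h)/h$. (A6) The integer $N=N_n$ satisfies $c_Nn^{2/5}\log n\le N\le C_Nn^{2/5}\log n$ for all large $n$, with constants $c_N,C_N>0$. Put $H=(N+1)^{-1}$. Let $I_J$ be the indicator function of $[JH,(J+1)H)$ for $J=0,\dots,N$. With $\|\varphi\|_{2,\alpha}=\{E\varphi^2(X_{i\alpha})\}^{1/2}$, put $$b_{J,\alpha}=I_{J+1}-\frac{\|I_{J+1}\|_{2,\alpha}}{\|I_J\|_{2,\alpha}}I_J,\qquad B_{J,\alpha}=\frac{b_{J,\alpha}}{\|b_{J,\alpha}\|_{2,\alpha}},\qquad J=0,\dots,N-1 .$$ For each sample size $n$ let $(\tilde\lambda_0,(\tilde\lambda_{J,\alpha}))\in\mathbb R^{1+dN}$ be any minimizer of $$\sum_{i=1}^n\Big\{m(\mathbf X_i)-\lambda_0-\sum_{\alpha=1}^d\sum_{J=0}^{N-1}\lambda_{J,\alpha}B_{J,\alpha}(X_{i\alpha})\Big\}^2,$$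 and let the noiseless spline pilot fit of the $\beta$-th component be $$\tilde m_\beta(x)=\sum_{J=0}^{N-1}\tilde\lambda_{J,\beta}B_{J,\beta}(x)-\frac1n\sum_{i=1}^n\sum_{J=0}^{N-1}\tilde\lambda_{J,\beta}B_{J,\beta}(X_{i\beta}).$$ Then for every $\beta\in\{2,\dots,d\}$ (in particular for $\beta=2$) the bias part $$\Psi_b(x_1)=\frac1n\sum_{i=1}^nK_h(X_{i1}-x_1)\{\tilde m_\beta(X_{i\beta})-m_\beta(X_{i\beta})\}$$ satisfies, as $n\to\infty$, $$\sup_{x_1\in[0,1]}|\Psi_b(x_1)|=O_p(n^{-1/2}+H)\qquad\text{and}\qquad \sup_{x_1\in[0,1]}|\Psi_b(x_1)|=o_p(n^{-2/5}).$$ -/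

import Mathlib

open MeasureTheory Filter Topology

noncomputable section

namespace SPBK

/-! ### Stochastic orders -/

/-- `W n = O_p(r n)`: for each `ε > 0` there is `M` with
`P(|W n| > M * r n) ≤ ε` for all large `n`. -/
def IsBigOp {Ω : Type*} [MeasurableSpace Ω] (P : Measure Ω) (W : ℕ → Ω → ℝ) (r : ℕ → ℝ) : Prop :=
  ∀ ε : ℝ, 0 < ε → ∃ M : ℝ, 0 < M ∧
    ∀ᶠ n in atTop, P {ω | M * r n < |W n ω|} ≤ ENNReal.ofReal ε

/-- `W n = o_p(r n)`: for each `δ > 0`, `P(|W n| > δ * r n) → 0`. -/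
def IsLittleOp {Ω : Type*} [MeasurableSpace Ω] (P : Measure Ω) (W : ℕ → Ω → ℝ) (r : ℕ → ℝ) : Prop :=
  ∀ δ : ℝ, 0 < δ → Tendsto (fun n => P {ω | δ * r n < |W n ω|}) atTop (𝓝 0)

/-! ### Strong mixing -/

/-- The `α`-mixing coefficient at lag `k` of a process `Z`: the supremum of
`|P(B ∩ C) - P(B) P(C)|` over all `t`, all `B ∈ σ(Z_s, s ≤ t)` and all `C ∈ σ(Z_s, s ≥ t + k)`. -/
def mixingCoeff {Ω E : Type*} [MeasurableSpace Ω] [mE : MeasurableSpace E] (P : Measure Ω)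
    (Z : ℕ → Ω → E) (k : ℕ) : ℝ :=
  sSup {r : ℝ | ∃ (t : ℕ) (B C : Set Ω),
    MeasurableSet[⨆ s ∈ {s : ℕ | s ≤ t}, mE.comap (Z s)] B ∧
    MeasurableSet[⨆ s ∈ {s : ℕ | t + k ≤ s}, mE.comap (Z s)] C ∧
    r = |P.real (B ∩ C) - P.real B * P.real C|}

/-- Geometric `α`-mixing. -/
def GeometricallyMixing {Ω E : Type*} [MeasurableSpace Ω] [MeasurableSpace E] (P : Measure Ω)
    (Z : ℕ → Ω → E) : Prop :=
  ∃ K₀ lam₀ : ℝ, 0 < K₀ ∧ 0 < lam₀ ∧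
    ∀ k : ℕ, 1 ≤ k → mixingCoeff P Z k ≤ K₀ * Real.exp (-lam₀ * k)

/-! ### Assumptions on components, design, kernel, bandwidth and knots -/

/-- The first component (index `0`) is `C²` on `[0,1]`; all the others are Lipschitz on `[0,1]` with
a common constant. -/
def ComponentSmoothness {d : ℕ} [NeZero d] (m : Fin d → ℝ → ℝ) : Prop :=
  ContDiffOn ℝ 2 (m 0) (Set.Icc 0 1) ∧
  ∃ C : ℝ, 0 < C ∧ ∀ β : Fin d, β ≠ 0 → ∀ x ∈ Set.Icc (0 : ℝ) 1, ∀ y ∈ Set.Icc (0 : ℝ) 1,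
    |m β x - m β y| ≤ C * |x - y|

/-- Every `X i` has the same density `f` on `[0,1]^d`, continuous and bounded away from `0` and `∞`
there; its one-dimensional marginal densities are `C¹` on `[0,1]`, with the same bounds. -/
def DesignDensity {Ω : Type*} [MeasurableSpace Ω] {d : ℕ} (P : Measure Ω)
    (X : ℕ → Ω → (Fin d → ℝ)) : Prop :=
  ∃ (f : (Fin d → ℝ) → ℝ) (fm : Fin d → ℝ → ℝ) (c_f C_f : ℝ), 0 < c_f ∧
    (∀ i, P.map (X i) =
      (volume.restrict (Set.Icc (0 : Fin d → ℝ) 1)).withDensity (fun x => ENNReal.ofReal (f x))) ∧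
    ContinuousOn f (Set.Icc 0 1) ∧
    (∀ x ∈ Set.Icc (0 : Fin d → ℝ) 1, c_f ≤ f x ∧ f x ≤ C_f) ∧
    ∀ α : Fin d,
      (∀ i, P.map (fun ω => X i ω α) =
        (volume.restrict (Set.Icc (0 : ℝ) 1)).withDensity (fun t => ENNReal.ofReal (fm α t))) ∧
      ContDiffOn ℝ 1 (fm α) (Set.Icc 0 1) ∧
      ∀ t ∈ Set.Icc (0 : ℝ) 1, c_f ≤ fm α t ∧ fm α t ≤ C_f

/-- The kernel is Lipschitz on `[-1,1]`, bounded, nonnegative, symmetric and vanishes off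
`[-1,1]`. -/
def KernelCondition (K : ℝ → ℝ) : Prop :=
  (∃ C : ℝ, 0 < C ∧ ∀ u ∈ Set.Icc (-1 : ℝ) 1, ∀ v ∈ Set.Icc (-1 : ℝ) 1,
    |K u - K v| ≤ C * |u - v|) ∧
  (∃ M : ℝ, ∀ u, K u ≤ M) ∧ (∀ u, 0 ≤ K u) ∧ (∀ u, K (-u) = K u) ∧ (∀ u, 1 < |u| → K u = 0)

/-- The bandwidth `h n` is of exact order `n^(-1/5)`. -/
def BandwidthOrder (h : ℕ → ℝ) : Prop :=
  ∃ c_h C_h : ℝ, 0 < c_h ∧ 0 < C_h ∧ ∀ᶠ n : ℕ in atTop,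
    c_h * (n : ℝ) ^ (-(1 / 5) : ℝ) ≤ h n ∧ h n ≤ C_h * (n : ℝ) ^ (-(1 / 5) : ℝ)

/-- The number of interior knots `N n` is of exact order `n^(2/5) log n`. -/
def KnotOrder (N : ℕ → ℕ) : Prop :=
  ∃ c_N C_N : ℝ, 0 < c_N ∧ 0 < C_N ∧ ∀ᶠ n : ℕ in atTop,
    c_N * ((n : ℝ) ^ (2 / 5 : ℝ) * Real.log n) ≤ N n ∧
    (N n : ℝ) ≤ C_N * ((n : ℝ) ^ (2 / 5 : ℝ) * Real.log n)

/-! ### The constant spline basis -/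

/-- The length `H = 1 / (N + 1)` of the subintervals. -/
def mesh (N : ℕ) : ℝ := 1 / ((N : ℝ) + 1)

/-- The indicator `I_J` of `[J H, (J + 1) H)`, for `J = 0, …, N`. -/
def stepFn (N J : ℕ) (x : ℝ) : ℝ :=
  (Set.Ico ((J : ℝ) * mesh N) (((J : ℝ) + 1) * mesh N)).indicator (fun _ => (1 : ℝ)) x

/-- The theoretical norm `‖φ‖₂ = (E φ(ξ)²)^(1/2)` where `ξ` has law `μ`. -/
def l2Norm (μ : Measure ℝ) (φ : ℝ → ℝ) : ℝ := Real.sqrt (∫ x, φ x ^ 2 ∂μ)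

/-- `b_J = I_{J+1} - (‖I_{J+1}‖₂ / ‖I_J‖₂) I_J`, for `J = 0, …, N - 1`. -/
def splineb (μ : Measure ℝ) (N J : ℕ) (x : ℝ) : ℝ :=
  stepFn N (J + 1) x - l2Norm μ (stepFn N (J + 1)) / l2Norm μ (stepFn N J) * stepFn N J x

/-- `B_J = b_J / ‖b_J‖₂`. -/
def splineB (μ : Measure ℝ) (N J : ℕ) (x : ℝ) : ℝ :=
  splineb μ N J x / l2Norm μ (splineb μ N J)

/-! ### The spline fit and its components -/

/-- Coefficients `(λ₀, (λ_{J,α}))` in `ℝ^(1 + d N)`. -/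
abbrev SplineCoeff (d N : ℕ) : Type := ℝ × (Fin d → Fin N → ℝ)

/-- The uncentered component `∑_J λ_{J,α} B_{J,α}` at `t`; `μ α` is the law of the `α`-th
predictor. -/
def splineComponent {d N : ℕ} (μ : Fin d → Measure ℝ) (a : SplineCoeff d N) (α : Fin d) (t : ℝ) :
    ℝ :=
  ∑ J : Fin N, a.2 α J * splineB (μ α) N (J : ℕ) t

/-- The additive spline `λ₀ + ∑_α ∑_J λ_{J,α} B_{J,α}(x_α)`. -/
def additiveSpline {d N : ℕ} (μ : Fin d → Measure ℝ) (a : SplineCoeff d N) (x : Fin d → ℝ) : ℝ :=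
  a.1 + ∑ α : Fin d, splineComponent μ a α (x α)

/-- `a` solves the least squares problem for the responses `y i` at the design points `x i`,
`i < n`. -/
def IsLeastSquares {d N : ℕ} (μ : Fin d → Measure ℝ) (n : ℕ) (x : ℕ → Fin d → ℝ) (y : ℕ → ℝ)
    (a : SplineCoeff d N) : Prop :=
  ∀ b : SplineCoeff d N,
    ∑ i ∈ Finset.range n, (y i - additiveSpline μ a (x i)) ^ 2 ≤
      ∑ i ∈ Finset.range n, (y i - additiveSpline μ b (x i)) ^ 2

/-- The empirically centered `α`-th component of the fit with coefficients `a`. -/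
def pilotComponent {d N : ℕ} (μ : Fin d → Measure ℝ) (n : ℕ) (x : ℕ → Fin d → ℝ)
    (a : SplineCoeff d N) (α : Fin d) (t : ℝ) : ℝ :=
  splineComponent μ a α t - (n : ℝ)⁻¹ * ∑ i ∈ Finset.range n, splineComponent μ a α (x i α)

/-- The additive regression function `m(x) = c + ∑_α m_α(x_α)`. -/
def additiveMean {d : ℕ} (c : ℝ) (m : Fin d → ℝ → ℝ) (x : Fin d → ℝ) : ℝ :=
  c + ∑ α : Fin d, m α (x α)

/-- `K_h(u) = K(u / h) / h`. -/
def scaledKernel (K : ℝ → ℝ) (h u : ℝ) : ℝ := K (u / h) / h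

/-- The bias part
`n⁻¹ ∑_i K_h(X_{i1} - x₁) {m̃_β(X_{iβ}) - m_β(X_{iβ})}` for the fit with coefficients `a`
(the first predictor has index `0`). -/
def biasPart {d N : ℕ} [NeZero d] (K : ℝ → ℝ) (h : ℝ) (m : Fin d → ℝ → ℝ) (μ : Fin d → Measure ℝ)
    (n : ℕ) (x : ℕ → Fin d → ℝ) (a : SplineCoeff d N) (β : Fin d) (x₁ : ℝ) : ℝ :=
  (n : ℝ)⁻¹ * ∑ i ∈ Finset.range n,
    scaledKernel K h (x i 0 - x₁) * (pilotComponent μ n x a β (x i β) - m β (x i β))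

end SPBK

end

noncomputable section

namespace SPBK

/-! The constant and the `splineB` functions of all coordinates together span all additive step
functions on the grid (`exists_spline_eq`). So the noiseless fit is at least as good as the step
function that takes the values of m at the left nodes, which is within O(H) of m. Hence the fit
minus this step approximation is an additive step function of empirical norm O(H)
(`mean_fit_sub_sq_le`).

To isolate one component, constants are shifted so that every component but the first has uniform
mean zero. The components are then orthogonal under the uniform law (`integral_additive_sq`), and
since the density is bounded below by some c > 0, the population squared norm is at least c H |w|²,
where w collects the step values. The empirical norm inherits this with half the constant once the
empirical Gram matrix is within c H / 2 of its expectation in Frobenius norm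
(`mean_additive_sq_ge`). Thus |w|² = O(H).

Up to constant terms and an O(H) discretization error, the bias part is Σ_J T_J(t) w_J with kernel
weights T_J(t) of the spline cells. A kernel window meets at most three strips of a grid of spacing
h, so Σ T_J(t)² = O(H) uniformly in t as soon as finitely many relative frequencies are close to
their probabilities (`sum_kernelMass_sq_le`); no chaining is needed, and Cauchy–Schwarz gives O(H).
Empirical centering cancels the unidentified constant and leaves the mean of w, which is O(H), and
the mean of the step approximation of m_β, whose expectation is O(H) because E m_β = 0 and whose
fluctuation is of order n^(-1/2) (`mean_sub_integral_sq_le`).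

Randomness enters, beyond a null event, only through squared errors of relative frequencies, bounded
by mixing and Markov's inequality (`sum_integral_freq_sub_sq_le`). For a partition into at most n
cells the total is O(n^(-9/10)), which is negligible against both H² and h² H. The logarithm in the
number of knots makes H = o(n^(-2/5)), which gives the second claim. -/

/-- The relative frequency of the event `A` among the first `n` terms of `x`. -/
def freq {E : Type*} (n : ℕ) (A : Set E) (x : ℕ → E) : ℝ :=
  (n : ℝ)⁻¹ * ∑ i ∈ Finset.range n, A.indicator (fun _ => (1 : ℝ)) (x i)

/-! ### Mean square errors of relative frequencies under mixing -/

section Mixing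

variable {Ω E : Type*} [MeasurableSpace Ω] [MeasurableSpace E] (P : Measure Ω)
  [IsProbabilityMeasure P]

/-- Makes the set in `mixingCoeff` bounded above; the real supremum of an unbounded set would be the
default value 0 and bound nothing. -/
theorem abs_prob_sub_le_one (B C : Set Ω) :
    |P.real (B ∩ C) - P.real B * P.real C| ≤ 1 := by
  have h1 : P.real (B ∩ C) ≤ 1 := measureReal_le_one
  have h2 : P.real B ≤ 1 := measureReal_le_one
  have h3 : P.real C ≤ 1 := measureReal_le_one
  have h4 : 0 ≤ P.real (B ∩ C) := measureReal_nonneg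
  have h5 : 0 ≤ P.real B := measureReal_nonneg
  have h6 : 0 ≤ P.real C := measureReal_nonneg
  rw [abs_le]
  constructor <;> nlinarith [mul_nonneg h5 h6]

theorem abs_cov_le_mixingCoeff (Z : ℕ → Ω → E) {B C : Set E} (hB : MeasurableSet B)
    (hC : MeasurableSet C) (i k : ℕ) :
    |P.real (Z i ⁻¹' B ∩ Z (i + k) ⁻¹' C) - P.real (Z i ⁻¹' B) * P.real (Z (i + k) ⁻¹' C)| ≤
      mixingCoeff P Z k := by
  refine le_csSup ⟨1, ?_⟩ ⟨i, Z i ⁻¹' B, Z (i + k) ⁻¹' C, ?_, ?_, rfl⟩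
  · rintro _ ⟨t, B, C, -, -, rfl⟩
    exact abs_prob_sub_le_one P B C
  · have : MeasurableSpace.comap (Z i) inferInstance ≤
        ⨆ s ∈ {s : ℕ | s ≤ i}, MeasurableSpace.comap (Z s) inferInstance :=
      le_iSup₂_of_le i (Nat.le_refl i) le_rfl
    exact this _ ⟨B, hB, rfl⟩
  · have : MeasurableSpace.comap (Z (i + k)) inferInstance ≤
        ⨆ s ∈ {s : ℕ | i + k ≤ s}, MeasurableSpace.comap (Z s) inferInstance :=
      le_iSup₂_of_le (i + k) (Nat.le_refl _) le_rfl
    exact this _ ⟨C, hC, rfl⟩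

/-- The covariances of the indicators of a common event decay geometrically along the process. -/
def EventDecay (X : ℕ → Ω → E) (K₀ lam : ℝ) : Prop :=
  ∀ A : Set E, MeasurableSet A → ∀ i k : ℕ, 1 ≤ k →
    |P.real (X i ⁻¹' A ∩ X (i + k) ⁻¹' A) - P.real (X i ⁻¹' A) * P.real (X (i + k) ⁻¹' A)| ≤
      K₀ * Real.exp (-lam * k)

/-- An event about the predictor alone is a cylinder in the pair, with the noise left free, so it
inherits the decay. -/
theorem GeometricallyMixing.eventDecay_fst {F : Type*} [MeasurableSpace F] {X : ℕ → Ω → E}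
    {Y : ℕ → Ω → F} (hmix : GeometricallyMixing P (fun i ω => (X i ω, Y i ω))) :
    ∃ K₀ lam : ℝ, 0 < K₀ ∧ 0 < lam ∧ EventDecay P X K₀ lam := by
  obtain ⟨K₀, lam, hK, hl, hdec⟩ := hmix
  refine ⟨K₀, lam, hK, hl, fun A hA i k hk => ?_⟩
  have h := abs_cov_le_mixingCoeff P (fun i ω => (X i ω, Y i ω))
    (hA.prod MeasurableSet.univ) (hA.prod MeasurableSet.univ) i k
  have e : ∀ j, (fun ω => (X j ω, Y j ω)) ⁻¹' (A ×ˢ (Set.univ : Set F)) = X j ⁻¹' A := by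
    intro j; ext; simp
  rw [e, e] at h
  exact h.trans (hdec k hk)

variable {P}

theorem integral_freq_sub_sq {X : ℕ → Ω → E} (hX : ∀ i, Measurable (X i)) {A : Set E}
    (hA : MeasurableSet A) {p : ℝ} (hp : ∀ i, P.real (X i ⁻¹' A) = p) {n : ℕ} (hn : 0 < n) :
    ∫ ω, (freq n A (fun i => X i ω) - p) ^ 2 ∂P =
      ((n : ℝ)⁻¹) ^ 2 * ∑ i ∈ Finset.range n, ∑ j ∈ Finset.range n,
        (P.real (X i ⁻¹' A ∩ X j ⁻¹' A) - p * p) := by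
  have hn' : (n : ℝ) ≠ 0 := by positivity
  have e : ∀ ω, (freq n A (fun i => X i ω) - p) ^ 2 =
      ((n : ℝ)⁻¹) ^ 2 * ∑ i ∈ Finset.range n, ∑ j ∈ Finset.range n,
        ((X i ⁻¹' A).indicator (fun _ => (1 : ℝ)) ω - p) *
          ((X j ⁻¹' A).indicator (fun _ => (1 : ℝ)) ω - p) := by
    intro ω
    rw [← Finset.sum_mul_sum, ← sq, ← mul_pow, Finset.sum_sub_distrib]
    congr 1
    simp only [freq, Set.indicator, Set.mem_preimage, Finset.sum_const, Finset.card_range,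
      nsmul_eq_mul]
    field_simp
    rfl
  have hm : ∀ i, MeasurableSet (X i ⁻¹' A) := fun i => hX i hA
  have hi : ∀ i, Integrable ((X i ⁻¹' A).indicator (fun _ => (1 : ℝ))) P := fun i =>
    (integrable_const _).indicator (hm i)
  have e2 : ∀ i j ω, ((X i ⁻¹' A).indicator (fun _ => (1 : ℝ)) ω - p) *
          ((X j ⁻¹' A).indicator (fun _ => (1 : ℝ)) ω - p) =
      (X i ⁻¹' A ∩ X j ⁻¹' A).indicator (fun _ => (1 : ℝ)) ω
        - p * (X i ⁻¹' A).indicator (fun _ => (1 : ℝ)) ω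
        - p * (X j ⁻¹' A).indicator (fun _ => (1 : ℝ)) ω + p * p := by
    intro i j ω
    by_cases h1 : ω ∈ X i ⁻¹' A <;> by_cases h2 : ω ∈ X j ⁻¹' A <;> simp [h1, h2] <;> ring
  have hij : ∀ i j, Integrable ((X i ⁻¹' A ∩ X j ⁻¹' A).indicator (fun _ => (1 : ℝ))) P :=
    fun i j => (integrable_const _).indicator ((hm i).inter (hm j))
  have hint : ∀ i j, Integrable (fun ω => ((X i ⁻¹' A).indicator (fun _ => (1 : ℝ)) ω - p) *
          ((X j ⁻¹' A).indicator (fun _ => (1 : ℝ)) ω - p)) P := by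
    intro i j
    simp only [e2]
    exact (((hij i j).sub ((hi i).const_mul p)).sub ((hi j).const_mul p)).add (integrable_const _)
  simp only [e]
  rw [integral_const_mul, integral_finsetSum _ fun i _ => integrable_finsetSum _ fun j _ => hint i j]
  congr 1
  refine Finset.sum_congr rfl fun i _ => ?_
  rw [integral_finsetSum _ fun j _ => hint i j]
  refine Finset.sum_congr rfl fun j _ => ?_
  simp only [e2]
  have h1 : Integrable (fun ω => (X i ⁻¹' A ∩ X j ⁻¹' A).indicator (fun _ => (1 : ℝ)) ω
        - p * (X i ⁻¹' A).indicator (fun _ => (1 : ℝ)) ω) P := (hij i j).sub ((hi i).const_mul p)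
  have h2 : Integrable (fun ω => (X i ⁻¹' A ∩ X j ⁻¹' A).indicator (fun _ => (1 : ℝ)) ω
        - p * (X i ⁻¹' A).indicator (fun _ => (1 : ℝ)) ω
        - p * (X j ⁻¹' A).indicator (fun _ => (1 : ℝ)) ω) P := h1.sub ((hi j).const_mul p)
  rw [integral_add h2 (integrable_const _), integral_sub h1 ((hi j).const_mul p),
    integral_sub (hij i j) ((hi i).const_mul p), integral_const_mul, integral_const_mul,
    integral_indicator_const _ (hm i), integral_indicator_const _ (hm j),
    integral_indicator_const _ ((hm i).inter (hm j)), hp, hp]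
  simp

theorem integrable_freq_sub_sq {X : ℕ → Ω → E} (hX : ∀ i, Measurable (X i)) {A : Set E}
    (hA : MeasurableSet A) (p : ℝ) (n : ℕ) :
    Integrable (fun ω => (freq n A (fun i => X i ω) - p) ^ 2) P := by
  have hm : Measurable (fun ω => freq n A (fun i => X i ω)) := by
    unfold freq
    refine (Finset.measurable_fun_sum _ fun i _ => ?_).const_mul _
    exact (measurable_const.indicator hA).comp (hX i)
  have h0 : ∀ ω, 0 ≤ freq n A (fun i => X i ω) := fun ω =>
    mul_nonneg (by positivity) (Finset.sum_nonneg fun i _ => Set.indicator_nonneg (by simp) _)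
  have h1 : ∀ ω, freq n A (fun i => X i ω) ≤ 1 := by
    intro ω
    have : ∑ i ∈ Finset.range n, A.indicator (fun _ => (1 : ℝ)) (X i ω) ≤ n := by
      calc ∑ i ∈ Finset.range n, A.indicator (fun _ => (1 : ℝ)) (X i ω)
          ≤ ∑ i ∈ Finset.range n, (1 : ℝ) :=
            Finset.sum_le_sum fun i _ =>
              Set.indicator_apply_le' (fun _ => le_rfl) (fun _ => zero_le_one)
        _ = n := by simp
    unfold freq
    rcases Nat.eq_zero_or_pos n with rfl | hn
    · simp
    · rw [inv_mul_le_iff₀ (by positivity)]; simpa using this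
  refine Integrable.of_bound ((hm.sub_const p).pow_const 2).aestronglyMeasurable ((1 + |p|) ^ 2)
    (Eventually.of_forall fun ω => ?_)
  rw [Real.norm_eq_abs, abs_pow]
  gcongr
  exact (abs_sub _ _).trans (by rw [abs_of_nonneg (h0 ω)]; linarith [h1 ω])

/-- With truncated subtraction `(i - j) + (j - i)` is |i - j|; each side of i contributes at most a
full geometric series. -/
theorem sum_pow_dist_le {r : ℝ} (hr0 : 0 ≤ r) (hr1 : r < 1) (i n : ℕ) :
    ∑ j ∈ Finset.range n, r ^ ((i - j) + (j - i)) ≤ 2 * (1 - r)⁻¹ := by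
  have hg : ∀ s : Finset ℕ, ∑ k ∈ s, r ^ k ≤ (1 - r)⁻¹ := fun s => by
    rw [← tsum_geometric_of_lt_one hr0 hr1]
    exact (summable_geometric_of_lt_one hr0 hr1).sum_le_tsum s fun k _ => pow_nonneg hr0 k
  rw [← Finset.sum_filter_add_sum_filter_not _ (fun j => j ≤ i), two_mul]
  refine add_le_add ?_ ?_
  · rw [show ∑ j ∈ (Finset.range n).filter (fun j => j ≤ i), r ^ ((i - j) + (j - i)) =
      ∑ k ∈ ((Finset.range n).filter (fun j => j ≤ i)).image (fun j => i - j), r ^ k from ?_]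
    · exact hg _
    · rw [Finset.sum_image]
      · refine Finset.sum_congr rfl fun j hj => ?_
        rw [Finset.mem_filter] at hj
        congr 1; omega
      · intro a ha b hb hab
        simp only [Finset.coe_filter, Set.mem_ofPred_eq] at ha hb hab
        omega
  · rw [show ∑ j ∈ (Finset.range n).filter (fun j => ¬ j ≤ i), r ^ ((i - j) + (j - i)) =
      ∑ k ∈ ((Finset.range n).filter (fun j => ¬ j ≤ i)).image (fun j => j - i), r ^ k from ?_]
    · exact hg _
    · rw [Finset.sum_image]
      · refine Finset.sum_congr rfl fun j hj => ?_
        rw [Finset.mem_filter] at hj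
        congr 1; omega
      · intro a ha b hb hab
        simp only [Finset.coe_filter, Set.mem_ofPred_eq] at ha hb hab
        omega

/-- Interpolates between a trivial bound and a small one. Taking the mixing bound to the power θ
turns its factor, the number of cells, into a small power and keeps the geometric decay. -/
theorem le_two_mul_rpow {a y θ : ℝ} (hy : 0 ≤ y) (hθ0 : 0 < θ) (hθ1 : θ ≤ 1) (h2 : a ≤ 2)
    (hay : y < 1 → a ≤ y) : a ≤ 2 * y ^ θ := by
  rcases lt_or_ge y 1 with h | h
  · have h1 : y ≤ y ^ θ := by
      simpa using Real.rpow_le_rpow_of_exponent_ge' hy h.le hθ0.le hθ1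
    have := hay h
    linarith [Real.rpow_nonneg hy θ]
  · have := Real.one_le_rpow h hθ0.le
    linarith

/-- Total mean square error of the relative frequencies of the cells of a partition. -/
theorem sum_integral_freq_sub_sq_le {X : ℕ → Ω → E} (hX : ∀ i, Measurable (X i))
    {K₀ lam : ℝ} (hK : 0 < K₀) (hl : 0 < lam) (hdec : EventDecay P X K₀ lam)
    {θ : ℝ} (hθ0 : 0 < θ) (hθ1 : θ ≤ 1)
    {ι : Type*} (s : Finset ι) (hs : s.Nonempty) (A : ι → Set E) (p : ι → ℝ)
    (hA : ∀ c ∈ s, MeasurableSet (A c)) (hdisj : (s : Set ι).PairwiseDisjoint A)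
    (hp : ∀ c ∈ s, ∀ i, P.real (X i ⁻¹' A c) = p c) {n : ℕ} (hn : 0 < n) :
    ∑ c ∈ s, ∫ ω, (freq n (A c) (fun i => X i ω) - p c) ^ 2 ∂P ≤
      4 * (1 + K₀) ^ θ * (1 - Real.exp (-lam * θ))⁻¹ * (s.card : ℝ) ^ θ / n := by
  set r := Real.exp (-lam * θ) with hr
  have hr0 : 0 ≤ r := (Real.exp_pos _).le
  have hr1 : r < 1 := by rw [hr, Real.exp_lt_one_iff]; nlinarith
  have hcard : (1 : ℝ) ≤ s.card := by exact_mod_cast hs.card_pos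
  have hpn : ∀ c ∈ s, 0 ≤ p c := fun c hc => by rw [← hp c hc 0]; exact measureReal_nonneg
  have hp1 : ∀ c ∈ s, p c ≤ 1 := fun c hc => by rw [← hp c hc 0]; exact measureReal_le_one
  -- the joint probabilities of distinct cells sum up to at most one
  have hsum1 : ∀ i, ∀ B : Set Ω, MeasurableSet B → ∑ c ∈ s, P.real (X i ⁻¹' A c ∩ B) ≤ 1 := by
    intro i B hB
    rw [← measureReal_biUnion_finset]
    · exact measureReal_le_one
    · intro a ha b hb hab
      exact ((hdisj ha hb hab).preimage (X i)).mono Set.inter_subset_left Set.inter_subset_left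
    · exact fun c hc => (hX i (hA c hc)).inter hB
  -- Disjointness bounds the sum by 1 at every lag, mixing bounds it by card · K₀ e^(-lam k) at lag
  -- k ≥ 1. The factor 1 + K₀ in place of K₀ lets the same expression cover lag 0.
  have hterm : ∀ i j, ∑ c ∈ s, (P.real (X i ⁻¹' A c ∩ X j ⁻¹' A c) - p c * p c) ≤
      2 * (1 + K₀) ^ θ * (s.card : ℝ) ^ θ * r ^ ((i - j) + (j - i)) := by
    intro i j
    have e : 2 * (1 + K₀) ^ θ * (s.card : ℝ) ^ θ * r ^ ((i - j) + (j - i)) =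
        2 * ((1 + K₀) * s.card * Real.exp (-lam * (((i - j) + (j - i) : ℕ) : ℝ))) ^ θ := by
      rw [Real.mul_rpow (by positivity) (Real.exp_pos _).le, Real.mul_rpow (by positivity)
        (by positivity), ← Real.exp_mul, hr, ← Real.exp_nat_mul]
      ring_nf
    rw [e]
    have hle1 : ∑ c ∈ s, (P.real (X i ⁻¹' A c ∩ X j ⁻¹' A c) - p c * p c) ≤ 1 := by
      calc _ ≤ ∑ c ∈ s, P.real (X i ⁻¹' A c ∩ Set.univ) := by
            refine Finset.sum_le_sum fun c hc => ?_
            have : P.real (X i ⁻¹' A c ∩ X j ⁻¹' A c) ≤ P.real (X i ⁻¹' A c ∩ Set.univ) :=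
              measureReal_mono (by simp)
            nlinarith [hpn c hc]
        _ ≤ 1 := hsum1 i _ MeasurableSet.univ
    refine le_two_mul_rpow (by positivity) hθ0 hθ1 (by linarith) fun _ => ?_
    rcases lt_trichotomy i j with hij | rfl | hij
    · obtain ⟨k, rfl⟩ := Nat.exists_eq_add_of_lt hij
      calc _ ≤ ∑ c ∈ s, K₀ * Real.exp (-lam * ((k + 1 : ℕ) : ℝ)) := by
            refine Finset.sum_le_sum fun c hc => ?_
            have := hdec (A c) (hA c hc) i (k + 1) (by omega)
            rw [hp c hc, hp c hc] at this
            exact (le_abs_self _).trans this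
        _ ≤ _ := by
            rw [Finset.sum_const, nsmul_eq_mul,
              show (i - (i + k + 1)) + (i + k + 1 - i) = k + 1 by omega]
            have := (Real.exp_pos (-lam * ((k + 1 : ℕ) : ℝ)))
            nlinarith [mul_pos (lt_of_lt_of_le one_pos hcard) this]
    · simp only [Nat.sub_self, Nat.add_zero, Nat.cast_zero, mul_zero, Real.exp_zero, mul_one]
      nlinarith
    · obtain ⟨k, rfl⟩ := Nat.exists_eq_add_of_lt hij
      calc _ ≤ ∑ c ∈ s, K₀ * Real.exp (-lam * ((k + 1 : ℕ) : ℝ)) := by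
            refine Finset.sum_le_sum fun c hc => ?_
            have := hdec (A c) (hA c hc) j (k + 1) (by omega)
            rw [hp c hc, hp c hc, Set.inter_comm] at this
            exact (le_abs_self _).trans this
        _ ≤ _ := by
            rw [Finset.sum_const, nsmul_eq_mul,
              show (j + k + 1 - j) + (j - (j + k + 1)) = k + 1 by omega]
            have := (Real.exp_pos (-lam * ((k + 1 : ℕ) : ℝ)))
            nlinarith [mul_pos (lt_of_lt_of_le one_pos hcard) this]
  have hn' : (0 : ℝ) < n := by exact_mod_cast hn
  rw [Finset.sum_congr rfl fun c hc => integral_freq_sub_sq hX (hA c hc) (hp c hc) hn,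
    ← Finset.mul_sum, Finset.sum_comm, Finset.sum_congr rfl fun i _ => Finset.sum_comm]
  calc _ ≤ ((n : ℝ)⁻¹) ^ 2 * ∑ i ∈ Finset.range n, ∑ j ∈ Finset.range n,
        2 * (1 + K₀) ^ θ * (s.card : ℝ) ^ θ * r ^ ((i - j) + (j - i)) := by
        gcongr with i _ j _
        exact hterm i j
    _ ≤ ((n : ℝ)⁻¹) ^ 2 * ∑ i ∈ Finset.range n,
        2 * (1 + K₀) ^ θ * (s.card : ℝ) ^ θ * (2 * (1 - r)⁻¹) := by
        gcongr with i _
        rw [← Finset.mul_sum]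
        gcongr
        exact sum_pow_dist_le hr0 hr1 i n
    _ = _ := by
        rw [Finset.sum_const, Finset.card_range, nsmul_eq_mul]
        field_simp
        ring

/-- Markov's inequality for a finite sum of squared deviations of relative frequencies. -/
theorem measure_sum_freq_sub_sq_gt_le {X : ℕ → Ω → E} (hX : ∀ i, Measurable (X i))
    {ι : Type*} (s : Finset ι) (A : ι → Set E) (p : ι → ℝ)
    (hA : ∀ c ∈ s, MeasurableSet (A c)) {n : ℕ} {v δ : ℝ} (hδ : 0 < δ)
    (hv : ∑ c ∈ s, ∫ ω, (freq n (A c) (fun i => X i ω) - p c) ^ 2 ∂P ≤ v) :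
    P {ω | δ < ∑ c ∈ s, (freq n (A c) (fun i => X i ω) - p c) ^ 2} ≤ ENNReal.ofReal (v / δ) := by
  have hint := fun c hc => integrable_freq_sub_sq (P := P) hX (hA c hc) (p c) n
  have hm := mul_meas_ge_le_integral_of_nonneg (μ := P)
    (f := fun ω => ∑ c ∈ s, (freq n (A c) (fun i => X i ω) - p c) ^ 2)
    (Eventually.of_forall fun ω => Finset.sum_nonneg fun c _ => sq_nonneg _)
    (integrable_finsetSum s hint) δ
  rw [integral_finsetSum s hint] at hm
  rw [← ofReal_measureReal]
  refine ENNReal.ofReal_le_ofReal ?_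
  rw [le_div_iff₀ hδ, mul_comm]
  refine le_trans ?_ (hm.trans hv)
  refine mul_le_mul_of_nonneg_left (measureReal_mono (fun ω hω => ?_) (measure_ne_top _ _)) hδ.le
  rw [Set.mem_ofPred_eq] at hω ⊢
  exact hω.le

end Mixing

/-! ### Regular grids -/

/-- The index of the interval `[J δ, (J + 1) δ)` containing `t ≥ 0`. -/
def gridIdx (δ t : ℝ) : ℕ := ⌊t / δ⌋₊

theorem gridIdx_eq_iff {δ t : ℝ} (hδ : 0 < δ) (ht : 0 ≤ t) (J : ℕ) :
    gridIdx δ t = J ↔ t ∈ Set.Ico ((J : ℝ) * δ) (((J : ℝ) + 1) * δ) := by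
  rw [gridIdx, Nat.floor_eq_iff (by positivity), Set.mem_Ico, le_div_iff₀ hδ, div_lt_iff₀ hδ]

theorem measurable_gridIdx (δ : ℝ) : Measurable (gridIdx δ) :=
  Nat.measurable_floor.comp (measurable_id.div_const δ)

theorem mesh_pos (N : ℕ) : 0 < mesh N := by unfold mesh; positivity

theorem succ_mul_mesh (N : ℕ) : ((N : ℝ) + 1) * mesh N = 1 := by
  unfold mesh; field_simp

theorem gridIdx_mesh_lt {N : ℕ} {t : ℝ} (h0 : 0 ≤ t) (h1 : t < 1) : gridIdx (mesh N) t < N + 1 := by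
  have := (gridIdx_eq_iff (mesh_pos N) h0 _).1 rfl
  have h2 : (gridIdx (mesh N) t : ℝ) * mesh N < ((N : ℝ) + 1) * mesh N := by
    rw [succ_mul_mesh]; exact this.1.trans_lt h1
  exact_mod_cast lt_of_mul_lt_mul_right h2 (mesh_pos N).le

/-- The points whose coordinates `α` and `β` have the grid indices `J` and `J'`. -/
def cell {d : ℕ} (δ ε : ℝ) (α β : Fin d) (c : ℕ × ℕ) : Set (Fin d → ℝ) :=
  {x | gridIdx δ (x α) = c.1 ∧ gridIdx ε (x β) = c.2}

theorem measurableSet_cell {d : ℕ} (δ ε : ℝ) (α β : Fin d) (c : ℕ × ℕ) :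
    MeasurableSet (cell δ ε α β c) :=
  (((measurable_gridIdx δ).comp (measurable_pi_apply α)) (measurableSet_singleton c.1)).inter
    (((measurable_gridIdx ε).comp (measurable_pi_apply β)) (measurableSet_singleton c.2))

theorem disjoint_cell {d : ℕ} (δ ε : ℝ) (α β : Fin d) (s : Set (ℕ × ℕ)) :
    s.PairwiseDisjoint (cell δ ε α β) := by
  intro a _ b _ hab
  refine Set.disjoint_left.2 fun x hx hy => hab ?_
  exact Prod.ext (hx.1.symm.trans hy.1) (hx.2.symm.trans hy.2)

/-! ### The uniform law -/

/-- The uniform law on the unit interval. -/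
def unitMeasure : Measure ℝ := volume.restrict (Set.Icc 0 1)

instance : IsProbabilityMeasure unitMeasure := ⟨by simp [unitMeasure]⟩

/-- The uniform law on the unit cube. -/
def cubeMeasure (d : ℕ) : Measure (Fin d → ℝ) := Measure.pi fun _ => unitMeasure

instance (d : ℕ) : IsProbabilityMeasure (cubeMeasure d) := by unfold cubeMeasure; infer_instance

theorem volume_restrict_cube (d : ℕ) :
    (volume : Measure (Fin d → ℝ)).restrict (Set.Icc 0 1) = cubeMeasure d := by
  unfold cubeMeasure unitMeasure
  rw [← Measure.restrict_pi_pi, ← volume_pi]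
  congr 1
  exact (Set.pi_univ_Icc _ _).symm

/-- The half-open grid intervals miss the endpoint 1, where all the indicators vanish; it is null.
-/
theorem ae_unitMeasure : ∀ᵐ t ∂unitMeasure, 0 ≤ t ∧ t < 1 := by
  unfold unitMeasure
  rw [← Measure.restrict_congr_set Ico_ae_eq_Icc]
  exact ae_restrict_mem measurableSet_Ico

/-- Only an inequality, since for general δ the last interval may stick out of [0,1]. Negative
points, which the natural floor sends to index 0, are null. -/
theorem unitMeasure_gridIdx_le {δ : ℝ} (hδ : 0 < δ) (J : ℕ) :
    unitMeasure.real (gridIdx δ ⁻¹' {J}) ≤ δ := by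
  have h1 : unitMeasure (gridIdx δ ⁻¹' {J}) ≤ ENNReal.ofReal δ := by
    calc _ ≤ unitMeasure (Set.Ico ((J : ℝ) * δ) (((J : ℝ) + 1) * δ)) := by
          refine measure_mono_ae ?_
          filter_upwards [ae_unitMeasure] with t ht h
          exact (gridIdx_eq_iff hδ ht.1 J).1 h
      _ ≤ volume (Set.Ico ((J : ℝ) * δ) (((J : ℝ) + 1) * δ)) := Measure.restrict_apply_le _ _
      _ = ENNReal.ofReal δ := by rw [Real.volume_Ico]; ring_nf
  exact ENNReal.toReal_le_of_le_ofReal hδ.le h1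

theorem unitMeasure_gridIdx_mesh {N J : ℕ} (hJ : J < N + 1) :
    unitMeasure.real (gridIdx (mesh N) ⁻¹' {J}) = mesh N := by
  have h : unitMeasure (gridIdx (mesh N) ⁻¹' {J}) =
      unitMeasure (Set.Ico ((J : ℝ) * mesh N) (((J : ℝ) + 1) * mesh N)) := by
    refine measure_congr ?_
    filter_upwards [ae_unitMeasure] with t ht
    exact propext (gridIdx_eq_iff (mesh_pos N) ht.1 J)
  have hJ' : ((J : ℝ) + 1) ≤ N + 1 := by exact_mod_cast hJ
  have hsub : Set.Ico ((J : ℝ) * mesh N) (((J : ℝ) + 1) * mesh N) ⊆ Set.Icc 0 1 := by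
    intro t ht
    refine ⟨(mul_nonneg (Nat.cast_nonneg _) (mesh_pos N).le).trans ht.1, ht.2.le.trans ?_⟩
    exact (mul_le_mul_of_nonneg_right hJ' (mesh_pos N).le).trans (succ_mul_mesh N).le
  rw [measureReal_def, h, unitMeasure, Measure.restrict_apply measurableSet_Ico,
    Set.inter_eq_left.2 hsub, Real.volume_Ico,
    show ((J : ℝ) + 1) * mesh N - J * mesh N = mesh N by ring,
    ENNReal.toReal_ofReal (mesh_pos N).le]

theorem integrable_comp_gridIdx (N : ℕ) (φ : ℕ → ℝ) :
    Integrable (fun t => φ (gridIdx (mesh N) t)) unitMeasure := by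
  refine Integrable.of_bound ((measurable_from_nat.comp
    (measurable_gridIdx (mesh N))).aestronglyMeasurable) (∑ J ∈ Finset.range (N + 1), |φ J|) ?_
  filter_upwards [ae_unitMeasure] with t ht
  exact Finset.single_le_sum (f := fun J => |φ J|) (fun _ _ => abs_nonneg _)
    (Finset.mem_range.2 (gridIdx_mesh_lt ht.1 ht.2))

theorem integral_comp_gridIdx (N : ℕ) (φ : ℕ → ℝ) :
    ∫ t, φ (gridIdx (mesh N) t) ∂unitMeasure = mesh N * ∑ J ∈ Finset.range (N + 1), φ J := by
  have hm : ∀ J, MeasurableSet (gridIdx (mesh N) ⁻¹' {J}) := fun J =>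
    measurable_gridIdx _ (measurableSet_singleton J)
  have h : (fun t => φ (gridIdx (mesh N) t)) =ᵐ[unitMeasure] fun t =>
      ∑ J ∈ Finset.range (N + 1), (gridIdx (mesh N) ⁻¹' {J}).indicator (fun _ => φ J) t := by
    filter_upwards [ae_unitMeasure] with t ht
    rw [Finset.sum_eq_single (gridIdx (mesh N) t)]
    · simp
    · intro J _ hJ
      simp [hJ.symm]
    · intro h
      exact absurd (Finset.mem_range.2 (gridIdx_mesh_lt ht.1 ht.2)) h
  rw [integral_congr_ae h, integral_finsetSum _ fun J _ => (integrable_const _).indicator (hm J),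
    Finset.mul_sum]
  refine Finset.sum_congr rfl fun J hJ => ?_
  rw [integral_indicator_const _ (hm J), unitMeasure_gridIdx_mesh (Finset.mem_range.1 hJ)]
  rfl

theorem indepFun_coord {d : ℕ} {α β : Fin d} (hab : α ≠ β) {F G : Type*} [MeasurableSpace F]
    [MeasurableSpace G] {φ : ℝ → F} {ψ : ℝ → G} (hφ : Measurable φ) (hψ : Measurable ψ) :
    ProbabilityTheory.IndepFun (fun x : Fin d → ℝ => φ (x α)) (fun x => ψ (x β))
      (cubeMeasure d) := by
  have h := ProbabilityTheory.iIndepFun_pi (μ := fun _ : Fin d => unitMeasure)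
    (X := fun _ => (id : ℝ → ℝ)) (fun _ => measurable_id.aemeasurable)
  exact (h.indepFun hab).comp hφ hψ

theorem cubeMeasure_cell_le {d : ℕ} {δ ε : ℝ} (hδ : 0 < δ) (hε : 0 < ε) {α β : Fin d}
    (hab : α ≠ β) (c : ℕ × ℕ) : (cubeMeasure d).real (cell δ ε α β c) ≤ δ * ε := by
  have h := (indepFun_coord hab (measurable_gridIdx δ) (measurable_gridIdx ε)).measure_inter_preimage_eq_mul
    {c.1} {c.2} (measurableSet_singleton _) (measurableSet_singleton _)
  have e1 := (measurePreserving_eval (fun _ : Fin d => unitMeasure) α).measure_preimage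
    ((measurable_gridIdx δ (measurableSet_singleton c.1)).nullMeasurableSet)
  have e2 := (measurePreserving_eval (fun _ : Fin d => unitMeasure) β).measure_preimage
    ((measurable_gridIdx ε (measurableSet_singleton c.2)).nullMeasurableSet)
  have e3 : (cubeMeasure d) (cell δ ε α β c) =
      unitMeasure (gridIdx δ ⁻¹' {c.1}) * unitMeasure (gridIdx ε ⁻¹' {c.2}) := by
    rw [← e1, ← e2]; exact h
  rw [measureReal_def, e3, ENNReal.toReal_mul]
  exact mul_le_mul (unitMeasure_gridIdx_le hδ _) (unitMeasure_gridIdx_le hε _)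
    measureReal_nonneg hδ.le

theorem integrable_coord {d : ℕ} (N : ℕ) (φ : ℕ → ℝ) (α : Fin d) :
    Integrable (fun x => φ (gridIdx (mesh N) (x α))) (cubeMeasure d) :=
  (measurePreserving_eval (fun _ : Fin d => unitMeasure) α).integrable_comp_of_integrable
    (integrable_comp_gridIdx N φ)

theorem integral_coord {d : ℕ} (N : ℕ) (φ : ℕ → ℝ) (α : Fin d) :
    ∫ x, φ (gridIdx (mesh N) (x α)) ∂cubeMeasure d = mesh N * ∑ J ∈ Finset.range (N + 1), φ J := by
  rw [← integral_comp_gridIdx]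
  have h := measurePreserving_eval (fun _ : Fin d => unitMeasure) α
  have := integral_map (μ := cubeMeasure d) (φ := Function.eval α) h.measurable.aemeasurable
    (f := fun t => φ (gridIdx (mesh N) t)) (by
      exact (measurable_from_nat.comp (measurable_gridIdx (mesh N))).aestronglyMeasurable)
  rw [cubeMeasure, h.map_eq] at this
  exact this.symm

theorem integrable_coord_mul {d : ℕ} (N : ℕ) (w : Fin d → ℕ → ℝ) (α β : Fin d) :
    Integrable (fun x => w α (gridIdx (mesh N) (x α)) * w β (gridIdx (mesh N) (x β)))
      (cubeMeasure d) := by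
  rcases eq_or_ne α β with rfl | hab
  · exact integrable_coord N (fun J => w α J * w α J) α
  · exact (indepFun_coord hab (measurable_gridIdx _) (measurable_gridIdx _)).comp
      measurable_from_nat measurable_from_nat |>.integrable_mul
        (integrable_coord N (w α) α) (integrable_coord N (w β) β)

/-- Additive step functions whose components, but for the first, have mean zero: the components
are orthogonal under the uniform law. -/
theorem integral_additive_sq {d : ℕ} [NeZero d] (N : ℕ) (w : Fin d → ℕ → ℝ)
    (hw : ∀ α, α ≠ 0 → ∑ J ∈ Finset.range (N + 1), w α J = 0) :
    ∫ x, (∑ α, w α (gridIdx (mesh N) (x α))) ^ 2 ∂cubeMeasure d =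
      mesh N * ∑ α, ∑ J ∈ Finset.range (N + 1), w α J ^ 2 := by
  simp only [sq, Finset.sum_mul_sum]
  rw [integral_finsetSum _ fun α _ => integrable_finsetSum _ fun β _ => integrable_coord_mul N w α β,
    Finset.mul_sum]
  refine Finset.sum_congr rfl fun α _ => ?_
  rw [integral_finsetSum _ fun β _ => integrable_coord_mul N w α β, Finset.sum_eq_single α]
  · exact integral_coord N (fun J => w α J * w α J) α
  · intro β _ hab
    have h : ∫ x, w α (gridIdx (mesh N) (x α)) * w β (gridIdx (mesh N) (x β)) ∂cubeMeasure d =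
        (∫ x, w α (gridIdx (mesh N) (x α)) ∂cubeMeasure d) *
          ∫ x, w β (gridIdx (mesh N) (x β)) ∂cubeMeasure d :=
      ((indepFun_coord hab.symm (measurable_gridIdx _) (measurable_gridIdx _)).comp
        measurable_from_nat measurable_from_nat).integral_fun_mul_eq_mul_integral
        (integrable_coord N (w α) α).aestronglyMeasurable
        (integrable_coord N (w β) β).aestronglyMeasurable
    rw [h, integral_coord, integral_coord]
    -- Of two distinct indices at least one is not 0, so one factor of the cross term vanishes.
    rcases eq_or_ne α 0 with rfl | hα
    · rw [hw β hab]; simp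
    · rw [hw α hα]; simp
  · simp

/-! ### Comparison of the design with the uniform law -/

/-- The laws of the predictors lie between multiples of the uniform laws. -/
structure DesignBounds {Ω : Type*} [MeasurableSpace Ω] {d : ℕ} (P : Measure Ω)
    (X : ℕ → Ω → (Fin d → ℝ)) (c C : ℝ) : Prop where
  pos : 0 < c
  le : c ≤ C
  law : ∀ i, P.map (X i) = P.map (X 0)
  lower : ENNReal.ofReal c • cubeMeasure d ≤ P.map (X 0)
  upper : P.map (X 0) ≤ ENNReal.ofReal C • cubeMeasure d
  marginal_lower : ∀ α, ENNReal.ofReal c • unitMeasure ≤ P.map (fun ω => X 0 ω α)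
  marginal_upper : ∀ α, P.map (fun ω => X 0 ω α) ≤ ENNReal.ofReal C • unitMeasure

theorem withDensity_bounds {E : Type*} [MeasurableSpace E] {μ : Measure E} {S : Set E}
    (hS : MeasurableSet S) {f : E → ℝ} {c C : ℝ} (hf : ∀ x ∈ S, c ≤ f x ∧ f x ≤ C) :
    ENNReal.ofReal c • μ.restrict S ≤
        (μ.restrict S).withDensity (fun x => ENNReal.ofReal (f x)) ∧
      (μ.restrict S).withDensity (fun x => ENNReal.ofReal (f x)) ≤
        ENNReal.ofReal C • μ.restrict S := by
  rw [← withDensity_const, ← withDensity_const]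
  constructor <;> refine withDensity_mono ?_ <;>
    filter_upwards [ae_restrict_mem hS] with x hx
  · exact ENNReal.ofReal_le_ofReal (hf x hx).1
  · exact ENNReal.ofReal_le_ofReal (hf x hx).2

theorem DesignDensity.bounds {Ω : Type*} [MeasurableSpace Ω] {d : ℕ} {P : Measure Ω}
    {X : ℕ → Ω → (Fin d → ℝ)} (hdens : DesignDensity P X) :
    ∃ c C : ℝ, DesignBounds P X c C := by
  obtain ⟨f, fm, c, C, hc, hlaw, -, hf, hm⟩ := hdens
  have h0 := hf 0 ⟨le_rfl, zero_le_one⟩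
  refine ⟨c, C, hc, h0.1.trans h0.2, fun i => (hlaw i).trans (hlaw 0).symm, ?_, ?_, ?_, ?_⟩
  · rw [hlaw 0, ← volume_restrict_cube]
    exact (withDensity_bounds measurableSet_Icc hf).1
  · rw [hlaw 0, ← volume_restrict_cube]
    exact (withDensity_bounds measurableSet_Icc hf).2
  · intro α
    rw [(hm α).1 0]
    exact (withDensity_bounds measurableSet_Icc (hm α).2.2).1
  · intro α
    rw [(hm α).1 0]
    exact (withDensity_bounds measurableSet_Icc (hm α).2.2).2

namespace DesignBounds

variable {Ω : Type*} [MeasurableSpace Ω] {d : ℕ} {P : Measure Ω}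
  {X : ℕ → Ω → (Fin d → ℝ)} {c C : ℝ}

theorem C_pos (h : DesignBounds P X c C) : 0 < C := h.pos.trans_le h.le

theorem prob_eq (h : DesignBounds P X c C) (hX : ∀ i, Measurable (X i)) {A : Set (Fin d → ℝ)}
    (hA : MeasurableSet A) (i : ℕ) : P.real (X i ⁻¹' A) = (P.map (X 0)).real A := by
  rw [← h.law i, map_measureReal_apply (hX i) hA]

theorem real_le (h : DesignBounds P X c C) (A : Set (Fin d → ℝ)) :
    (P.map (X 0)).real A ≤ C * (cubeMeasure d).real A := by
  have h1 := h.upper A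
  have h2 := ENNReal.toReal_mono (by
    rw [Measure.smul_apply]; exact ENNReal.mul_ne_top ENNReal.ofReal_ne_top (measure_ne_top _ _)) h1
  rw [Measure.smul_apply, smul_eq_mul, ENNReal.toReal_mul, ENNReal.toReal_ofReal h.C_pos.le] at h2
  exact h2

theorem cell_le (h : DesignBounds P X c C) {δ ε : ℝ} (hδ : 0 < δ) (hε : 0 < ε) {α β : Fin d}
    (hab : α ≠ β) (q : ℕ × ℕ) : (P.map (X 0)).real (cell δ ε α β q) ≤ C * (δ * ε) :=
  (h.real_le _).trans (mul_le_mul_of_nonneg_left (cubeMeasure_cell_le hδ hε hab q) h.C_pos.le)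

theorem diag_cell_le (h : DesignBounds P X c C) {δ : ℝ} (hδ : 0 < δ) (α : Fin d)
    (q : ℕ × ℕ) : (P.map (X 0)).real (cell δ δ α α q) ≤ C * δ := by
  refine (h.real_le _).trans (mul_le_mul_of_nonneg_left ?_ h.C_pos.le)
  have e1 := (measurePreserving_eval (fun _ : Fin d => unitMeasure) α).measureReal_preimage
    ((measurable_gridIdx δ (measurableSet_singleton q.1)).nullMeasurableSet)
  refine le_trans ?_ (unitMeasure_gridIdx_le hδ q.1)
  rw [← e1]
  exact measureReal_mono (μ := cubeMeasure d) fun x hx => hx.1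

theorem ae_mem (h : DesignBounds P X c C) (hX : ∀ i, Measurable (X i)) :
    ∀ᵐ ω ∂P, ∀ i α, 0 ≤ X i ω α ∧ X i ω α < 1 := by
  rw [ae_all_iff]
  intro i
  rw [ae_all_iff]
  intro α
  have h1 : ∀ᵐ x ∂cubeMeasure d, 0 ≤ x α ∧ x α < 1 :=
    (measurePreserving_eval (fun _ : Fin d => unitMeasure) α).quasiMeasurePreserving.ae
      ae_unitMeasure
  have h2 : P.map (X i) ≪ cubeMeasure d := by
    rw [h.law i]
    exact (Measure.absolutelyContinuous_of_le h.upper).trans Measure.smul_absolutelyContinuous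
  exact ae_of_ae_map (hX i).aemeasurable (h2.ae_le h1)

/-- Orthogonality holds for the uniform law only; the lower density bound carries the resulting
inequality over to the dependent coordinates of the design. -/
theorem lower_integral_sq [NeZero d] (h : DesignBounds P X c C) (N : ℕ) (w : Fin d → ℕ → ℝ)
    (hw : ∀ α, α ≠ 0 → ∑ J ∈ Finset.range (N + 1), w α J = 0) :
    c * (mesh N * ∑ α, ∑ J ∈ Finset.range (N + 1), w α J ^ 2) ≤
      ∫ x, (∑ α, w α (gridIdx (mesh N) (x α))) ^ 2 ∂P.map (X 0) := by
  have hint : Integrable (fun x : Fin d → ℝ => (∑ α, w α (gridIdx (mesh N) (x α))) ^ 2)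
      (cubeMeasure d) := by
    simp only [sq, Finset.sum_mul_sum]
    exact integrable_finsetSum _ fun α _ => integrable_finsetSum _ fun β _ =>
      integrable_coord_mul N w α β
  rw [← integral_additive_sq N w hw, ← smul_eq_mul, ← ENNReal.toReal_ofReal h.pos.le,
    ← integral_smul_measure]
  exact integral_mono_measure h.lower (Eventually.of_forall fun x => sq_nonneg _)
    ((hint.smul_measure ENNReal.ofReal_ne_top).mono_measure h.upper)

end DesignBounds

/-! ### The span of the constant spline basis -/

theorem stepFn_eq_ite (N J : ℕ) {t : ℝ} (ht : 0 ≤ t) :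
    stepFn N J t = if J = gridIdx (mesh N) t then 1 else 0 := by
  unfold stepFn
  rw [Set.indicator_apply]
  refine if_congr ?_ rfl rfl
  rw [← gridIdx_eq_iff (mesh_pos N) ht, eq_comm]

theorem gridIdx_node (N J : ℕ) : gridIdx (mesh N) (J * mesh N) = J := by
  have h := mesh_pos N
  rw [gridIdx_eq_iff h (by positivity)]
  exact ⟨le_rfl, by nlinarith⟩

/-- Splines are constant on grid intervals, so a fit is described by its values at left nodes. -/
theorem splineComponent_node {d N : ℕ} (μ : Fin d → Measure ℝ) (a : SplineCoeff d N) (α : Fin d)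
    {t : ℝ} (ht : 0 ≤ t) :
    splineComponent μ a α t = splineComponent μ a α (gridIdx (mesh N) t * mesh N) := by
  have h : ∀ J, stepFn N J t = stepFn N J (gridIdx (mesh N) t * mesh N) := fun J => by
    rw [stepFn_eq_ite N J ht, stepFn_eq_ite N J (mul_nonneg (Nat.cast_nonneg _) (mesh_pos N).le),
      gridIdx_node]
  simp only [splineComponent, splineB, splineb, h]

theorem stepFn_sq (N J : ℕ) (x : ℝ) : stepFn N J x ^ 2 = stepFn N J x := by
  unfold stepFn
  by_cases h : x ∈ Set.Ico ((J : ℝ) * mesh N) (((J : ℝ) + 1) * mesh N) <;> simp [h]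

/-- Keeps the divisors `l2Norm μ (stepFn N J)` in `splineb` away from the convention x / 0 = 0. -/
theorem integral_stepFn_pos {μ : Measure ℝ} [IsFiniteMeasure μ] {c : ℝ} (hc : 0 < c)
    (hμ : ENNReal.ofReal c • unitMeasure ≤ μ) {N J : ℕ} (hJ : J < N + 1) :
    0 < ∫ x, stepFn N J x ^ 2 ∂μ := by
  simp only [stepFn_sq]
  unfold stepFn
  rw [integral_indicator_const _ measurableSet_Ico, smul_eq_mul, mul_one, measureReal_def,
    ENNReal.toReal_pos_iff]
  refine ⟨lt_of_lt_of_le ?_ (hμ _), measure_lt_top _ _⟩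
  rw [Measure.smul_apply, smul_eq_mul]
  refine ENNReal.mul_pos (by simpa using hc) ?_
  intro h0
  have h := unitMeasure_gridIdx_mesh hJ
  have h1 : unitMeasure (gridIdx (mesh N) ⁻¹' {J}) = 0 := by
    rw [← h0]
    refine measure_congr ?_
    filter_upwards [ae_unitMeasure] with t ht
    exact propext (gridIdx_eq_iff (mesh_pos N) ht.1 J)
  rw [measureReal_def, h1, ENNReal.toReal_zero] at h
  exact (mesh_pos N).ne h

theorem measurable_stepFn (N J : ℕ) : Measurable (stepFn N J) :=
  measurable_const.indicator measurableSet_Ico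

theorem abs_stepFn_le (N J : ℕ) (x : ℝ) : |stepFn N J x| ≤ 1 := by
  unfold stepFn
  by_cases h : x ∈ Set.Ico ((J : ℝ) * mesh N) (((J : ℝ) + 1) * mesh N) <;> simp [h]

/-- Neighbouring indicators have disjoint supports, so the cross term drops out and the norm is at
least that of `stepFn N (J + 1)`. -/
theorem l2Norm_splineb_pos {μ : Measure ℝ} [IsFiniteMeasure μ] {c : ℝ} (hc : 0 < c)
    (hμ : ENNReal.ofReal c • unitMeasure ≤ μ) {N J : ℕ} (hJ : J < N) :
    0 < l2Norm μ (splineb μ N J) := by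
  unfold l2Norm
  refine Real.sqrt_pos.2 ((integral_stepFn_pos hc hμ (Nat.succ_lt_succ hJ)).trans_le ?_)
  have hm : Measurable (splineb μ N J) :=
    (measurable_stepFn N (J + 1)).sub ((measurable_stepFn N J).const_mul _)
  refine integral_mono_of_nonneg (Eventually.of_forall fun x => sq_nonneg _) ?_
    (Eventually.of_forall fun x => ?_)
  · refine Integrable.of_bound (hm.pow_const 2).aestronglyMeasurable
      ((1 + |l2Norm μ (stepFn N (J + 1)) / l2Norm μ (stepFn N J)| * 1) ^ 2)
      (Eventually.of_forall fun x => ?_)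
    rw [Real.norm_eq_abs, abs_pow]
    unfold splineb
    gcongr
    refine (abs_sub _ _).trans ?_
    rw [abs_mul]
    gcongr
    · exact abs_stepFn_le _ _ _
    · exact abs_stepFn_le _ _ _
  · have h : stepFn N (J + 1) x * stepFn N J x = 0 := by
      unfold stepFn
      by_cases h1 : x ∈ Set.Ico ((J : ℝ) * mesh N) (((J : ℝ) + 1) * mesh N)
      · have h2 : x ∉ Set.Ico (((J + 1 : ℕ) : ℝ) * mesh N) ((((J + 1 : ℕ) : ℝ) + 1) * mesh N) := by
          intro h3
          have := h3.1
          push_cast at this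
          exact absurd h1.2 (not_lt.2 this)
        rw [Set.indicator_of_notMem h2, zero_mul]
      · simp [h1]
    have e : splineb μ N J x ^ 2 = stepFn N (J + 1) x ^ 2 +
        (l2Norm μ (stepFn N (J + 1)) / l2Norm μ (stepFn N J) * stepFn N J x) ^ 2 -
        2 * (l2Norm μ (stepFn N (J + 1)) / l2Norm μ (stepFn N J)) *
          (stepFn N (J + 1) x * stepFn N J x) := by
      unfold splineb; ring
    change stepFn N (J + 1) x ^ 2 ≤ splineb μ N J x ^ 2
    rw [e, h]
    nlinarith [sq_nonneg (l2Norm μ (stepFn N (J + 1)) / l2Norm μ (stepFn N J) * stepFn N J x)]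

/-- Every step function on the grid is a constant plus a combination of the `B_J`. -/
theorem exists_spline_eq {μ : Measure ℝ} [IsFiniteMeasure μ] {c : ℝ} (hc : 0 < c)
    (hμ : ENNReal.ofReal c • unitMeasure ≤ μ) (N : ℕ) (v : ℕ → ℝ) :
    ∃ (κ : ℝ) (l : Fin N → ℝ), ∀ t : ℝ, 0 ≤ t → t < 1 →
      κ + ∑ J : Fin N, l J * splineB μ N J t = v (gridIdx (mesh N) t) := by
  set w : ℕ → ℝ := fun J => l2Norm μ (stepFn N J) with hw
  have hwpos : ∀ J, J < N + 1 → 0 < w J := fun J hJ =>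
    Real.sqrt_pos.2 (integral_stepFn_pos hc hμ hJ)
  set W := ∑ J ∈ Finset.range (N + 1), w J with hW
  have hWpos : 0 < W := Finset.sum_pos (fun J hJ => hwpos J (Finset.mem_range.1 hJ)) ⟨0, by simp⟩
  -- The indicator coefficients of each `splineb` are orthogonal to the weights w. So κ has to be
  -- the w-weighted mean of v, which makes v - κ orthogonal to w.
  set κ := (∑ J ∈ Finset.range (N + 1), v J * w J) / W with hκ
  set S : ℕ → ℝ := fun J => ∑ i ∈ Finset.range J, (v i - κ) * w i with hS
  have hSsucc : ∀ J, S (J + 1) = S J + (v J - κ) * w J := fun J => Finset.sum_range_succ _ _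
  have hSN : S (N + 1) = 0 := by
    simp only [hS, sub_mul, Finset.sum_sub_distrib, ← Finset.mul_sum]
    rw [← hW, hκ, div_mul_cancel₀ _ hWpos.ne', sub_self]
  refine ⟨κ, fun J => -(S (J + 1) / w (J + 1)) * l2Norm μ (splineb μ N J), fun t ht0 ht1 => ?_⟩
  have hk := gridIdx_mesh_lt (N := N) ht0 ht1
  -- Summation by parts: with the partial sums S of (v - κ) w as coefficients, each term is a
  -- telescoping difference plus the wanted (v J - κ) I_J. The boundary term at N supplies the last
  -- indicator because S (N + 1) = 0.
  have hterm : ∀ J, J < N → -(S (J + 1) / w (J + 1)) * l2Norm μ (splineb μ N J) * splineB μ N J t =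
      ((-(S (J + 1) / w (J + 1) * stepFn N (J + 1) t)) - (-(S J / w J * stepFn N J t))) +
        (v J - κ) * stepFn N J t := by
    intro J hJ
    have h1 := (hwpos (J + 1) (by omega)).ne'
    have h2 := (hwpos J (by omega)).ne'
    have h3 := (l2Norm_splineb_pos hc hμ hJ).ne'
    have h4 : l2Norm μ (splineb μ N J) * splineB μ N J t =
        stepFn N (J + 1) t - w (J + 1) / w J * stepFn N J t := by
      rw [splineB, mul_div_cancel₀ _ h3, splineb]
    rw [mul_assoc, h4, hSsucc]
    field_simp
    ring
  rw [Fin.sum_univ_eq_sum_range (fun J => -(S (J + 1) / w (J + 1)) * l2Norm μ (splineb μ N J) *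
    splineB μ N J t), Finset.sum_congr rfl fun J hJ => hterm J (Finset.mem_range.1 hJ),
    Finset.sum_add_distrib, Finset.sum_range_sub (fun J => -(S J / w J * stepFn N J t))]
  have hS0 : S 0 = 0 := by simp [hS]
  have hN : -(S N / w N * stepFn N N t) = (v N - κ) * stepFn N N t := by
    have h1 := (hwpos N (by omega)).ne'
    have : S N = -((v N - κ) * w N) := by linarith [hSsucc N]
    rw [this]
    field_simp
  have hsum : ∑ J ∈ Finset.range (N + 1), (v J - κ) * stepFn N J t =
      v (gridIdx (mesh N) t) - κ := by
    simp only [stepFn_eq_ite N _ ht0, mul_ite, mul_one, mul_zero]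
    rw [Finset.sum_ite_eq' _ _ (fun J => v J - κ), if_pos (Finset.mem_range.2 hk)]
  rw [Finset.sum_range_succ] at hsum
  rw [hN, hS0, zero_div, zero_mul, neg_zero]
  linarith

theorem exists_additiveSpline_eq {d : ℕ} {μ : Fin d → Measure ℝ} [∀ α, IsFiniteMeasure (μ α)]
    {c : ℝ} (hc : 0 < c) (hμ : ∀ α, ENNReal.ofReal c • unitMeasure ≤ μ α) (N : ℕ) (c₀ : ℝ)
    (v : Fin d → ℕ → ℝ) :
    ∃ b : SplineCoeff d N, ∀ x : Fin d → ℝ, (∀ α, 0 ≤ x α ∧ x α < 1) →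
      additiveSpline μ b x = c₀ + ∑ α, v α (gridIdx (mesh N) (x α)) := by
  choose κ l hl using fun α => exists_spline_eq hc (hμ α) N (v α)
  refine ⟨(c₀ + ∑ α, κ α, l), fun x hx => ?_⟩
  simp only [additiveSpline, splineComponent]
  rw [add_assoc, ← Finset.sum_add_distrib]
  congr 1
  exact Finset.sum_congr rfl fun α _ => hl α (x α) (hx α).1 (hx α).2

/-! ### The empirical Gram matrix -/

/-- The sample points with index below `n` lie in `[0,1)^d`. -/
def InCube {d : ℕ} (n : ℕ) (x : ℕ → Fin d → ℝ) : Prop :=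
  ∀ i < n, ∀ α, 0 ≤ x i α ∧ x i α < 1

/-- The indices of the entries of the Gram matrix of all the indicators `I_J(x_α)`. -/
def gramIdx (d N : ℕ) : Finset ((Fin d × Fin d) × (ℕ × ℕ)) :=
  Finset.univ ×ˢ (Finset.range (N + 1) ×ˢ Finset.range (N + 1))

/-- The event whose probability is an entry of the Gram matrix. -/
def gramCell {d : ℕ} (N : ℕ) (q : (Fin d × Fin d) × (ℕ × ℕ)) : Set (Fin d → ℝ) :=
  cell (mesh N) (mesh N) q.1.1 q.1.2 q.2

/-- The squared length of a family of step function coefficients. -/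
def sqLen {d : ℕ} (N : ℕ) (w : Fin d → ℕ → ℝ) : ℝ :=
  ∑ α, ∑ J ∈ Finset.range (N + 1), w α J ^ 2

theorem sqLen_nonneg {d : ℕ} (N : ℕ) (w : Fin d → ℕ → ℝ) : 0 ≤ sqLen N w :=
  Finset.sum_nonneg fun _ _ => Finset.sum_nonneg fun _ _ => sq_nonneg _

theorem sum_sq_le_sqLen {d : ℕ} (N : ℕ) (w : Fin d → ℕ → ℝ) (β : Fin d) :
    ∑ J ∈ Finset.range (N + 1), w β J ^ 2 ≤ sqLen N w :=
  Finset.single_le_sum (f := fun α => ∑ J ∈ Finset.range (N + 1), w α J ^ 2)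
    (fun _ _ => Finset.sum_nonneg fun _ _ => sq_nonneg _) (Finset.mem_univ β)

theorem sum_cell_eq {d : ℕ} (δ ε : ℝ) (α β : Fin d) (R S : ℕ) (φ : ℕ × ℕ → ℝ) {x : Fin d → ℝ}
    (hα : gridIdx δ (x α) < R) (hβ : gridIdx ε (x β) < S) :
    ∑ c ∈ Finset.range R ×ˢ Finset.range S,
      φ c * (cell δ ε α β c).indicator (fun _ => (1 : ℝ)) x =
        φ (gridIdx δ (x α), gridIdx ε (x β)) := by
  rw [Finset.sum_eq_single (gridIdx δ (x α), gridIdx ε (x β))]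
  · have hmem : x ∈ cell δ ε α β (gridIdx δ (x α), gridIdx ε (x β)) := ⟨rfl, rfl⟩
    rw [Set.indicator_of_mem hmem, mul_one]
  · intro c _ hc
    rw [Set.indicator_of_notMem, mul_zero]
    exact fun h => hc (Prod.ext h.1.symm h.2.symm)
  · intro h
    exact absurd (Finset.mem_product.2 ⟨Finset.mem_range.2 hα, Finset.mem_range.2 hβ⟩) h

/-- Averaged over the sample or over the law, this makes both squared norms the same quadratic form,
in relative frequencies and in probabilities respectively. -/
theorem additive_sq_eq {d : ℕ} (N : ℕ) (w : Fin d → ℕ → ℝ) {x : Fin d → ℝ}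
    (hx : ∀ α, 0 ≤ x α ∧ x α < 1) :
    (∑ α, w α (gridIdx (mesh N) (x α))) ^ 2 =
      ∑ q ∈ gramIdx d N, w q.1.1 q.2.1 * w q.1.2 q.2.2 *
        (gramCell N q).indicator (fun _ => (1 : ℝ)) x := by
  rw [gramIdx, Finset.sum_product, Fintype.sum_prod_type, sq, Finset.sum_mul_sum]
  refine Finset.sum_congr rfl fun α _ => Finset.sum_congr rfl fun β _ => ?_
  exact (sum_cell_eq (mesh N) (mesh N) α β (N + 1) (N + 1) (fun c => w α c.1 * w β c.2)
    (gridIdx_mesh_lt (hx α).1 (hx α).2) (gridIdx_mesh_lt (hx β).1 (hx β).2)).symm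

theorem mean_sum_indicator {E ι : Type*} (n : ℕ) (x : ℕ → E) (s : Finset ι) (φ : ι → ℝ)
    (A : ι → Set E) :
    (n : ℝ)⁻¹ * ∑ i ∈ Finset.range n, ∑ c ∈ s, φ c * (A c).indicator (fun _ => (1 : ℝ)) (x i) =
      ∑ c ∈ s, φ c * freq n (A c) x := by
  rw [Finset.sum_comm, Finset.mul_sum]
  refine Finset.sum_congr rfl fun c _ => ?_
  rw [freq, ← Finset.mul_sum]
  ring

theorem integral_sum_indicator {E ι : Type*} [MeasurableSpace E] (π : Measure E) [IsFiniteMeasure π]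
    (s : Finset ι) (φ : ι → ℝ) (A : ι → Set E) (hA : ∀ c ∈ s, MeasurableSet (A c)) :
    ∫ x, ∑ c ∈ s, φ c * (A c).indicator (fun _ => (1 : ℝ)) x ∂π = ∑ c ∈ s, φ c * π.real (A c) := by
  rw [integral_finsetSum _ fun c hc => ((integrable_const _).indicator (hA c hc)).const_mul _]
  refine Finset.sum_congr rfl fun c hc => ?_
  rw [integral_const_mul, integral_indicator_const _ (hA c hc)]
  simp

theorem mean_additive_sq_eq {d : ℕ} {n : ℕ} {x : ℕ → Fin d → ℝ} (hx : InCube n x) (N : ℕ)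
    (w : Fin d → ℕ → ℝ) :
    (n : ℝ)⁻¹ * ∑ i ∈ Finset.range n, (∑ α, w α (gridIdx (mesh N) (x i α))) ^ 2 =
      ∑ q ∈ gramIdx d N, w q.1.1 q.2.1 * w q.1.2 q.2.2 * freq n (gramCell N q) x := by
  rw [← mean_sum_indicator]
  congr 1
  exact Finset.sum_congr rfl fun i hi => additive_sq_eq N w (hx i (Finset.mem_range.1 hi))

theorem integral_additive_sq_eq {d : ℕ} (π : Measure (Fin d → ℝ)) [IsFiniteMeasure π]
    (hπ : ∀ᵐ x ∂π, ∀ α, 0 ≤ x α ∧ x α < 1) (N : ℕ) (w : Fin d → ℕ → ℝ) :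
    ∫ x, (∑ α, w α (gridIdx (mesh N) (x α))) ^ 2 ∂π =
      ∑ q ∈ gramIdx d N, w q.1.1 q.2.1 * w q.1.2 q.2.2 * π.real (gramCell N q) := by
  rw [← integral_sum_indicator π (gramIdx d N) (fun q => w q.1.1 q.2.1 * w q.1.2 q.2.2)
    (gramCell N) fun q _ => measurableSet_cell _ _ _ _ _]
  refine integral_congr_ae ?_
  filter_upwards [hπ] with x hx
  exact additive_sq_eq N w hx

theorem sum_coeff_sq {d : ℕ} (N : ℕ) (w : Fin d → ℕ → ℝ) :
    ∑ q ∈ gramIdx d N, (w q.1.1 q.2.1 * w q.1.2 q.2.2) ^ 2 = sqLen N w ^ 2 := by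
  rw [gramIdx, Finset.sum_product, Fintype.sum_prod_type, sq (sqLen N w), sqLen,
    Finset.sum_mul_sum]
  refine Finset.sum_congr rfl fun α _ => Finset.sum_congr rfl fun β _ => ?_
  rw [Finset.sum_product, Finset.sum_mul_sum]
  exact Finset.sum_congr rfl fun J _ => Finset.sum_congr rfl fun J' _ => mul_pow _ _ _

/-- If the relative frequencies are close to the probabilities, the empirical norm of an additive
step function dominates the length of its coefficients. -/
theorem mean_additive_sq_ge {d : ℕ} {n : ℕ} {x : ℕ → Fin d → ℝ} (hx : InCube n x) {N : ℕ}
    {w : Fin d → ℕ → ℝ} {p : (Fin d × Fin d) × (ℕ × ℕ) → ℝ} {b : ℝ} (hb : 0 ≤ b)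
    (hlow : b * sqLen N w ≤ ∑ q ∈ gramIdx d N, w q.1.1 q.2.1 * w q.1.2 q.2.2 * p q)
    (hgram : ∑ q ∈ gramIdx d N, (freq n (gramCell N q) x - p q) ^ 2 ≤ (b / 2) ^ 2) :
    b / 2 * sqLen N w ≤
      (n : ℝ)⁻¹ * ∑ i ∈ Finset.range n, (∑ α, w α (gridIdx (mesh N) (x i α))) ^ 2 := by
  rw [mean_additive_sq_eq hx]
  -- The array of products w w' has Frobenius norm exactly `sqLen N w`, so the two quadratic forms
  -- differ by at most b / 2 times it.
  have hcs := Finset.sum_mul_sq_le_sq_mul_sq (gramIdx d N)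
    (fun q => w q.1.1 q.2.1 * w q.1.2 q.2.2) (fun q => freq n (gramCell N q) x - p q)
  rw [sum_coeff_sq] at hcs
  have hdiff : ∑ q ∈ gramIdx d N, w q.1.1 q.2.1 * w q.1.2 q.2.2 * (freq n (gramCell N q) x - p q) =
      ∑ q ∈ gramIdx d N, w q.1.1 q.2.1 * w q.1.2 q.2.2 * freq n (gramCell N q) x -
      ∑ q ∈ gramIdx d N, w q.1.1 q.2.1 * w q.1.2 q.2.2 * p q := by
    rw [← Finset.sum_sub_distrib]
    exact Finset.sum_congr rfl fun q _ => mul_sub _ _ _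
  rw [hdiff] at hcs
  have h2 : (∑ q ∈ gramIdx d N, w q.1.1 q.2.1 * w q.1.2 q.2.2 * freq n (gramCell N q) x -
      ∑ q ∈ gramIdx d N, w q.1.1 q.2.1 * w q.1.2 q.2.2 * p q) ^ 2 ≤ (sqLen N w * (b / 2)) ^ 2 := by
    rw [mul_pow]
    exact hcs.trans (mul_le_mul_of_nonneg_left hgram (sq_nonneg _))
  have h3 := (abs_le_of_sq_le_sq' h2 (mul_nonneg (sqLen_nonneg N w) (by positivity))).1
  linarith

/-! ### Least squares with an approximately additive step response -/

theorem additiveSpline_node {d N : ℕ} (μ : Fin d → Measure ℝ) (a : SplineCoeff d N)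
    {x : Fin d → ℝ} (hx : ∀ α, 0 ≤ x α ∧ x α < 1) :
    additiveSpline μ a x =
      a.1 + ∑ α, splineComponent μ a α (gridIdx (mesh N) (x α) * mesh N) := by
  unfold additiveSpline
  congr 1
  exact Finset.sum_congr rfl fun α _ => splineComponent_node μ a α (hx α).1

theorem node_dist_le {N : ℕ} {t : ℝ} (ht : 0 ≤ t) :
    |gridIdx (mesh N) t * mesh N - t| ≤ mesh N := by
  have h := (gridIdx_eq_iff (mesh_pos N) ht _).1 rfl
  rw [abs_le]
  constructor <;> nlinarith [h.1, h.2, mesh_pos N]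

theorem node_mem {N : ℕ} {t : ℝ} (ht0 : 0 ≤ t) (ht1 : t < 1) :
    (gridIdx (mesh N) t : ℝ) * mesh N ∈ Set.Icc (0 : ℝ) 1 :=
  ⟨mul_nonneg (Nat.cast_nonneg _) (mesh_pos N).le,
    (((gridIdx_eq_iff (mesh_pos N) ht0 _).1 rfl).1.trans_lt ht1).le⟩

/-- The least squares fit of `m` differs from the step approximation of `m` by `O(H)` in the
empirical norm. -/
theorem mean_fit_sub_sq_le {d : ℕ} {μ : Fin d → Measure ℝ} [∀ α, IsFiniteMeasure (μ α)]
    {c : ℝ} (hc : 0 < c) (hμ : ∀ α, ENNReal.ofReal c • unitMeasure ≤ μ α) {n N : ℕ} (hn : 0 < n)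
    {x : ℕ → Fin d → ℝ} (hx : InCube n x) {c₀ : ℝ} {m : Fin d → ℝ → ℝ} {l : ℝ} (hl : 0 ≤ l)
    (hm : ∀ α, ∀ s ∈ Set.Icc (0 : ℝ) 1, ∀ t ∈ Set.Icc (0 : ℝ) 1, |m α s - m α t| ≤ l * |s - t|)
    {a : SplineCoeff d N}
    (ha : IsLeastSquares μ n x (fun i => additiveMean c₀ m (x i)) a) :
    (n : ℝ)⁻¹ * ∑ i ∈ Finset.range n, (a.1 - c₀ + ∑ α,
      (splineComponent μ a α (gridIdx (mesh N) (x i α) * mesh N) -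
        m α (gridIdx (mesh N) (x i α) * mesh N))) ^ 2 ≤ 4 * (d * (l * mesh N)) ^ 2 := by
  -- The competitor in the least squares problem: the step function with the values of m at the left
  -- nodes.
  obtain ⟨b, hb⟩ := exists_additiveSpline_eq hc hμ N c₀ (fun α J => m α (J * mesh N))
  have hclose : ∀ i < n, (additiveMean c₀ m (x i) - additiveSpline μ b (x i)) ^ 2 ≤
      (d * (l * mesh N)) ^ 2 := by
    intro i hi
    rw [hb _ (hx i hi), additiveMean, add_sub_add_left_eq_sub, ← Finset.sum_sub_distrib, ← sq_abs]
    refine pow_le_pow_left₀ (abs_nonneg _) ?_ 2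
    refine (Finset.abs_sum_le_sum_abs _ _).trans ?_
    have : ∀ α ∈ Finset.univ, |m α (x i α) - m α (gridIdx (mesh N) (x i α) * mesh N)| ≤
        l * mesh N := fun α _ => by
      have h := hx i hi α
      refine (hm α _ ⟨h.1, h.2.le⟩ _ (node_mem h.1 h.2)).trans ?_
      rw [abs_sub_comm]
      exact mul_le_mul_of_nonneg_left (node_dist_le h.1) hl
    exact (Finset.sum_le_sum this).trans (by simp)
  have hsum : ∑ i ∈ Finset.range n, (additiveMean c₀ m (x i) - additiveSpline μ b (x i)) ^ 2 ≤
      n * (d * (l * mesh N)) ^ 2 := by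
    refine (Finset.sum_le_sum fun i hi => hclose i (Finset.mem_range.1 hi)).trans ?_
    simp
  have hpt : ∀ i ∈ Finset.range n, (a.1 - c₀ + ∑ α,
      (splineComponent μ a α (gridIdx (mesh N) (x i α) * mesh N) -
        m α (gridIdx (mesh N) (x i α) * mesh N))) ^ 2 ≤
      2 * (additiveMean c₀ m (x i) - additiveSpline μ a (x i)) ^ 2 +
      2 * (additiveMean c₀ m (x i) - additiveSpline μ b (x i)) ^ 2 := by
    intro i hi
    have h := hx i (Finset.mem_range.1 hi)
    have e : a.1 - c₀ + ∑ α, (splineComponent μ a α (gridIdx (mesh N) (x i α) * mesh N) -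
        m α (gridIdx (mesh N) (x i α) * mesh N)) =
        additiveSpline μ a (x i) - additiveSpline μ b (x i) := by
      rw [additiveSpline_node μ a h, hb _ h, Finset.sum_sub_distrib]
      ring
    rw [e]
    nlinarith [sq_nonneg ((additiveMean c₀ m (x i) - additiveSpline μ a (x i)) +
      (additiveMean c₀ m (x i) - additiveSpline μ b (x i)))]
  have hn' : (0 : ℝ) < n := by exact_mod_cast hn
  rw [inv_mul_le_iff₀ hn']
  refine (Finset.sum_le_sum hpt).trans ?_
  rw [Finset.sum_add_distrib, ← Finset.mul_sum, ← Finset.mul_sum]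
  -- Optimality replaces the residual of a by that of b, so the two terms with factor 2 add up to
  -- the constant 4.
  have := ha b
  linarith

/-- An additive step function is a sum of components that, but for the first, have mean zero; a
component other than the first changes by a constant only. -/
theorem exists_centered {d : ℕ} [NeZero d] (N : ℕ) (u₀ : ℝ) (v : Fin d → ℕ → ℝ) :
    ∃ w : Fin d → ℕ → ℝ, (∀ α, α ≠ 0 → ∑ J ∈ Finset.range (N + 1), w α J = 0) ∧
      (∀ k : Fin d → ℕ, u₀ + ∑ α, v α (k α) = ∑ α, w α (k α)) ∧
      ∀ β, ∃ κ : ℝ, ∀ J, v β J = w β J + κ := by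
  set μ : Fin d → ℝ := fun α => mesh N * ∑ J ∈ Finset.range (N + 1), v α J with hμ
  -- Each component loses its uniform mean; all these means and u₀ are put into component 0, which
  -- stays uncentered.
  refine ⟨fun α J => v α J - μ α + if α = 0 then u₀ + ∑ β, μ β else 0, ?_, ?_, ?_⟩
  · intro α hα
    simp only [if_neg hα, add_zero, Finset.sum_sub_distrib, Finset.sum_const, Finset.card_range,
      nsmul_eq_mul]
    push_cast
    rw [hμ, ← mul_assoc, succ_mul_mesh]
    ring
  · intro k
    rw [Finset.sum_add_distrib, Finset.sum_sub_distrib, Finset.sum_ite_eq' Finset.univ (0 : Fin d)]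
    simp only [Finset.mem_univ, if_true]
    ring
  · intro β
    exact ⟨μ β - if β = 0 then u₀ + ∑ γ, μ γ else 0, fun J => by ring⟩

/-! ### Kernel weights of the spline cells -/

/-- The kernel weight at `t` of the sample points whose `β`-th coordinate lies in the `J`-th
interval. -/
def kernelMass {d : ℕ} [NeZero d] (K : ℝ → ℝ) (h : ℝ) (N n : ℕ) (x : ℕ → Fin d → ℝ) (β : Fin d)
    (t : ℝ) (J : ℕ) : ℝ :=
  (n : ℝ)⁻¹ * ∑ i ∈ Finset.range n,
    if gridIdx (mesh N) (x i β) = J then scaledKernel K h (x i 0 - t) else 0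

theorem mean_kernel_mul_eq {d : ℕ} [NeZero d] (K : ℝ → ℝ) (h : ℝ) {N n : ℕ} {x : ℕ → Fin d → ℝ}
    (hx : InCube n x) (β : Fin d) (t : ℝ) (φ : ℕ → ℝ) :
    (n : ℝ)⁻¹ * ∑ i ∈ Finset.range n,
      scaledKernel K h (x i 0 - t) * φ (gridIdx (mesh N) (x i β)) =
        ∑ J ∈ Finset.range (N + 1), kernelMass K h N n x β t J * φ J := by
  have h1 : ∀ i ∈ Finset.range n, scaledKernel K h (x i 0 - t) * φ (gridIdx (mesh N) (x i β)) =
      ∑ J ∈ Finset.range (N + 1),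
        (if gridIdx (mesh N) (x i β) = J then scaledKernel K h (x i 0 - t) else 0) * φ J := by
    intro i hi
    have hk := hx i (Finset.mem_range.1 hi) β
    simp only [ite_mul, zero_mul]
    rw [Finset.sum_ite_eq, if_pos (Finset.mem_range.2 (gridIdx_mesh_lt hk.1 hk.2))]
  rw [Finset.sum_congr rfl h1, Finset.sum_comm, Finset.mul_sum]
  refine Finset.sum_congr rfl fun J _ => ?_
  rw [kernelMass, ← Finset.sum_mul, mul_assoc]

/-- The grid spacing equals the bandwidth, so the window around any t is covered by three strips,
and uniformity in t reduces to finitely many strips. At index 0 the truncated `- 1` is harmless. -/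
theorem gridIdx_near {h s t : ℝ} (hh : 0 < h) (hs : 0 ≤ s) (ht : 0 ≤ t) (hst : |s - t| ≤ h) :
    gridIdx h s ∈ Finset.Icc (gridIdx h t - 1) (gridIdx h t + 1) := by
  have h1 := (gridIdx_eq_iff hh hs _).1 rfl
  have h2 := (gridIdx_eq_iff hh ht _).1 rfl
  rw [abs_le] at hst
  have a1 : ((gridIdx h s : ℝ)) * h < (gridIdx h t + 2) * h := by linarith [h1.1, h2.2]
  have a2 : ((gridIdx h t : ℝ)) * h < (gridIdx h s + 2) * h := by linarith [h1.2, h2.1]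
  have b1 := lt_of_mul_lt_mul_right a1 hh.le
  have b2 := lt_of_mul_lt_mul_right a2 hh.le
  have c1 : gridIdx h s < gridIdx h t + 2 := by exact_mod_cast b1
  have c2 : gridIdx h t < gridIdx h s + 2 := by exact_mod_cast b2
  rw [Finset.mem_Icc]
  omega

theorem kernelMass_nonneg {d : ℕ} [NeZero d] {K : ℝ → ℝ} (hK0 : ∀ u, 0 ≤ K u) {h : ℝ} (hh : 0 < h)
    (N n : ℕ) (x : ℕ → Fin d → ℝ) (β : Fin d) (t : ℝ) (J : ℕ) :
    0 ≤ kernelMass K h N n x β t J := by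
  refine mul_nonneg (by positivity) (Finset.sum_nonneg fun i _ => ?_)
  split_ifs
  · exact div_nonneg (hK0 _) hh.le
  · exact le_rfl

/-- The kernel is at most M and lives on the window, so it is dominated by M / h times the
indicators of three strips. The bound sees t only through its strip index. -/
theorem kernelMass_le {d : ℕ} [NeZero d] {K : ℝ → ℝ} {M : ℝ} (hK0 : ∀ u, 0 ≤ K u)
    (hKM : ∀ u, K u ≤ M) (hKs : ∀ u, 1 < |u| → K u = 0) {h : ℝ} (hh : 0 < h) {N n : ℕ}
    {x : ℕ → Fin d → ℝ} (hx : InCube n x) (β : Fin d) {t : ℝ} (ht : 0 ≤ t) (J : ℕ) :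
    kernelMass K h N n x β t J ≤
      M / h * ∑ k ∈ Finset.Icc (gridIdx h t - 1) (gridIdx h t + 1),
        freq n (cell h (mesh N) 0 β (k, J)) x := by
  have hM : 0 ≤ M := (hK0 0).trans (hKM 0)
  rw [Finset.mul_sum, ← mean_sum_indicator, kernelMass]
  refine mul_le_mul_of_nonneg_left (Finset.sum_le_sum fun i hi => ?_) (by positivity)
  have hnn : 0 ≤ ∑ k ∈ Finset.Icc (gridIdx h t - 1) (gridIdx h t + 1),
      M / h * (cell h (mesh N) 0 β (k, J)).indicator (fun _ => (1 : ℝ)) (x i) :=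
    Finset.sum_nonneg fun k _ => mul_nonneg (by positivity)
      (Set.indicator_nonneg (fun _ _ => zero_le_one) _)
  split_ifs with hJ
  · rcases le_or_gt |x i 0 - t| h with hle | hgt
    · have hk := gridIdx_near hh (hx i (Finset.mem_range.1 hi) 0).1 ht hle
      refine le_trans ?_ (Finset.single_le_sum (f := fun k => M / h *
        (cell h (mesh N) 0 β (k, J)).indicator (fun _ => (1 : ℝ)) (x i)) (fun k _ =>
          mul_nonneg (by positivity) (Set.indicator_nonneg (fun _ _ => zero_le_one) _)) hk)
      have hmem : x i ∈ cell h (mesh N) 0 β (gridIdx h (x i 0), J) := ⟨rfl, hJ⟩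
      rw [Set.indicator_of_mem hmem, mul_one, scaledKernel]
      exact div_le_div_of_nonneg_right (hKM _) hh.le
    · have : scaledKernel K h (x i 0 - t) = 0 := by
        rw [scaledKernel, hKs, zero_div]
        rwa [abs_div, abs_of_pos hh, one_lt_div hh]
      rw [this]
      exact hnn
  · exact hnn

/-- The kernel weights of the spline cells are of order `H` in mean square. -/
theorem sum_kernelMass_sq_le {d : ℕ} [NeZero d] {K : ℝ → ℝ} {M : ℝ} (hK0 : ∀ u, 0 ≤ K u)
    (hKM : ∀ u, K u ≤ M) (hKs : ∀ u, 1 < |u| → K u = 0) {h : ℝ} (hh : 0 < h) {N n L : ℕ}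
    {x : ℕ → Fin d → ℝ} (hx : InCube n x) (β : Fin d) {p : ℕ × ℕ → ℝ} {C : ℝ}
    (hp0 : ∀ q, 0 ≤ p q) (hp : ∀ q, p q ≤ C * (h * mesh N)) (hL : gridIdx h 1 + 2 ≤ L)
    (hfreq : ∑ q ∈ Finset.range L ×ˢ Finset.range (N + 1),
      (freq n (cell h (mesh N) 0 β q) x - p q) ^ 2 ≤ h ^ 2 * mesh N)
    {t : ℝ} (ht0 : 0 ≤ t) (ht1 : t ≤ 1) :
    ∑ J ∈ Finset.range (N + 1), kernelMass K h N n x β t J ^ 2 ≤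
      6 * M ^ 2 * (3 * C ^ 2 + 1) * mesh N := by
  have hM : 0 ≤ M := (hK0 0).trans (hKM 0)
  have hH := mesh_pos N
  set T := Finset.Icc (gridIdx h t - 1) (gridIdx h t + 1) with hT
  set f : ℕ × ℕ → ℝ := fun q => freq n (cell h (mesh N) 0 β q) x with hf
  have hTcard : (T.card : ℝ) ≤ 3 := by
    have : T.card ≤ 3 := by rw [hT, Nat.card_Icc]; omega
    exact_mod_cast this
  -- The largest strip index is `gridIdx h 1 + 1`, hence the `+ 2` in the hypothesis on L.
  have hTsub : T ⊆ Finset.range L := by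
    intro k hk
    have h1 : gridIdx h t ≤ gridIdx h 1 := Nat.floor_mono (div_le_div_of_nonneg_right ht1 hh.le)
    rw [hT, Finset.mem_Icc] at hk
    rw [Finset.mem_range]
    omega
  -- The 3 is Cauchy–Schwarz over three strips; then f² ≤ 2 p² + 2 (f - p)², whose gap is (f - 2
  -- p)².
  have hJ : ∀ J ∈ Finset.range (N + 1), kernelMass K h N n x β t J ^ 2 ≤
      (M / h) ^ 2 * (3 * ∑ k ∈ T, (2 * (C * (h * mesh N)) ^ 2 + 2 * (f (k, J) - p (k, J)) ^ 2)) := by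
    intro J _
    calc kernelMass K h N n x β t J ^ 2 ≤ (M / h * ∑ k ∈ T, f (k, J)) ^ 2 :=
          pow_le_pow_left₀ (kernelMass_nonneg hK0 hh N n x β t J)
            (kernelMass_le hK0 hKM hKs hh hx β ht0 J) 2
      _ = (M / h) ^ 2 * (∑ k ∈ T, f (k, J)) ^ 2 := mul_pow _ _ _
      _ ≤ _ := by
          refine mul_le_mul_of_nonneg_left ?_ (sq_nonneg _)
          refine sq_sum_le_card_mul_sum_sq.trans ?_
          refine mul_le_mul hTcard (Finset.sum_le_sum fun k _ => ?_)
            (Finset.sum_nonneg fun _ _ => sq_nonneg _) (by norm_num)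
          have := pow_le_pow_left₀ (hp0 (k, J)) (hp (k, J)) 2
          nlinarith [sq_nonneg (f (k, J) - 2 * p (k, J))]
  refine (Finset.sum_le_sum hJ).trans ?_
  rw [← Finset.mul_sum, ← Finset.mul_sum]
  have hsum : ∑ J ∈ Finset.range (N + 1),
      ∑ k ∈ T, (2 * (C * (h * mesh N)) ^ 2 + 2 * (f (k, J) - p (k, J)) ^ 2) ≤
      6 * C ^ 2 * h ^ 2 * mesh N + 2 * (h ^ 2 * mesh N) := by
    simp only [Finset.sum_add_distrib, ← Finset.mul_sum]
    refine add_le_add ?_ (mul_le_mul_of_nonneg_left ?_ (by norm_num))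
    · rw [Finset.sum_const, Finset.sum_const, Finset.card_range, nsmul_eq_mul, nsmul_eq_mul]
      push_cast
      calc 2 * (((N : ℝ) + 1) * (T.card * (C * (h * mesh N)) ^ 2))
          ≤ 2 * (((N : ℝ) + 1) * (3 * (C * (h * mesh N)) ^ 2)) := by gcongr
        _ = (((N : ℝ) + 1) * mesh N) * (6 * C ^ 2 * h ^ 2 * mesh N) := by ring
        _ = _ := by rw [succ_mul_mesh, one_mul]
    · refine le_trans ?_ hfreq
      rw [Finset.sum_product, Finset.sum_comm]
      exact Finset.sum_le_sum_of_subset_of_nonneg hTsub fun _ _ _ =>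
        Finset.sum_nonneg fun _ _ => sq_nonneg _
  calc (M / h) ^ 2 * (3 * ∑ J ∈ Finset.range (N + 1),
      ∑ k ∈ T, (2 * (C * (h * mesh N)) ^ 2 + 2 * (f (k, J) - p (k, J)) ^ 2))
      ≤ (M / h) ^ 2 * (3 * (6 * C ^ 2 * h ^ 2 * mesh N + 2 * (h ^ 2 * mesh N))) := by gcongr
    _ = _ := by field_simp; ring

/-! ### Means of step functions with small increments -/

/-- The points whose coordinate `β` lies beyond the `J`-th interval. -/
def tailSet {d : ℕ} (δ : ℝ) (β : Fin d) (J : ℕ) : Set (Fin d → ℝ) :=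
  {x | J < gridIdx δ (x β)}

theorem measurableSet_tailSet {d : ℕ} (δ : ℝ) (β : Fin d) (J : ℕ) :
    MeasurableSet (tailSet δ β J) :=
  ((measurable_gridIdx δ).comp (measurable_pi_apply β)) (measurableSet_Ioi (a := J))

/-- Summation by parts trades step values, of order one, for increments, of order H for a Lipschitz
function. -/
theorem eq_sum_tailSet {d : ℕ} {N : ℕ} (g : ℕ → ℝ) (β : Fin d) {x : Fin d → ℝ}
    (hx : 0 ≤ x β ∧ x β < 1) :
    g (gridIdx (mesh N) (x β)) = g 0 + ∑ J ∈ Finset.range N,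
      (g (J + 1) - g J) * (tailSet (mesh N) β J).indicator (fun _ => (1 : ℝ)) x := by
  have hk := gridIdx_mesh_lt (N := N) hx.1 hx.2
  have h1 : ∑ J ∈ Finset.range N,
      (g (J + 1) - g J) * (tailSet (mesh N) β J).indicator (fun _ => (1 : ℝ)) x =
      ∑ J ∈ Finset.range (gridIdx (mesh N) (x β)), (g (J + 1) - g J) := by
    rw [← Finset.sum_subset (Finset.range_subset_range.2 (by omega : gridIdx (mesh N) (x β) ≤ N))]
    · refine Finset.sum_congr rfl fun J hJ => ?_
      have : x ∈ tailSet (mesh N) β J := Finset.mem_range.1 hJ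
      rw [Set.indicator_of_mem this, mul_one]
    · intro J _ hJ
      have : x ∉ tailSet (mesh N) β J := fun h => hJ (Finset.mem_range.2 h)
      rw [Set.indicator_of_notMem this, mul_zero]
  rw [h1, Finset.sum_range_sub]
  ring

/-- Cauchy–Schwarz after summation by parts: the squared increments sum to at most l² H, the squared
tail errors to V (N + 1), and (N + 1) H = 1. With V of order 1 / n this is the parametric rate, with
no loss from the number of cells. -/
theorem mean_sub_integral_sq_le {d : ℕ} (π : Measure (Fin d → ℝ)) [IsProbabilityMeasure π]
    (hπ : ∀ᵐ x ∂π, ∀ α, 0 ≤ x α ∧ x α < 1) {n : ℕ} (hn : 0 < n) {x : ℕ → Fin d → ℝ}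
    (hx : InCube n x) {N : ℕ} (β : Fin d) {g : ℕ → ℝ} {l V : ℝ}
    (hg : ∀ J < N, |g (J + 1) - g J| ≤ l * mesh N)
    (htail : ∑ J ∈ Finset.range N,
      (freq n (tailSet (mesh N) β J) x - π.real (tailSet (mesh N) β J)) ^ 2 ≤ V * (N + 1)) :
    ((n : ℝ)⁻¹ * ∑ i ∈ Finset.range n, g (gridIdx (mesh N) (x i β)) -
      ∫ y, g (gridIdx (mesh N) (y β)) ∂π) ^ 2 ≤ l ^ 2 * V := by
  have hn' : (n : ℝ) ≠ 0 := by positivity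
  have hH := mesh_pos N
  have e1 : (n : ℝ)⁻¹ * ∑ i ∈ Finset.range n, g (gridIdx (mesh N) (x i β)) =
      g 0 + ∑ J ∈ Finset.range N, (g (J + 1) - g J) * freq n (tailSet (mesh N) β J) x := by
    rw [← mean_sum_indicator, Finset.sum_congr rfl fun i hi =>
      eq_sum_tailSet g β (hx i (Finset.mem_range.1 hi) β), Finset.sum_add_distrib]
    simp only [Finset.sum_const, Finset.card_range, nsmul_eq_mul]
    field_simp
  have e2 : ∫ y, g (gridIdx (mesh N) (y β)) ∂π =
      g 0 + ∑ J ∈ Finset.range N, (g (J + 1) - g J) * π.real (tailSet (mesh N) β J) := by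
    have h1 : (fun y : Fin d → ℝ => g (gridIdx (mesh N) (y β))) =ᵐ[π] fun y =>
        g 0 + ∑ J ∈ Finset.range N,
          (g (J + 1) - g J) * (tailSet (mesh N) β J).indicator (fun _ => (1 : ℝ)) y := by
      filter_upwards [hπ] with y hy
      exact eq_sum_tailSet g β (hy β)
    rw [integral_congr_ae h1, integral_add (integrable_const _)
      (integrable_finsetSum _ fun J _ => ((integrable_const _).indicator
        (measurableSet_tailSet _ _ _)).const_mul _),
      integral_sum_indicator π _ (fun J => g (J + 1) - g J) _
        fun J _ => measurableSet_tailSet _ _ _]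
    simp
  rw [e1, e2, add_sub_add_left_eq_sub, ← Finset.sum_sub_distrib]
  simp only [← mul_sub]
  refine (Finset.sum_mul_sq_le_sq_mul_sq _ _ _).trans ?_
  have h3 : ∑ J ∈ Finset.range N, (g (J + 1) - g J) ^ 2 ≤ N * (l * mesh N) ^ 2 := by
    calc _ ≤ ∑ J ∈ Finset.range N, (l * mesh N) ^ 2 := Finset.sum_le_sum fun J hJ => by
          rw [← sq_abs]
          exact pow_le_pow_left₀ (abs_nonneg _) (hg J (Finset.mem_range.1 hJ)) 2
      _ = _ := by simp
  have h4 : (N : ℝ) * (l * mesh N) ^ 2 ≤ l ^ 2 * mesh N := by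
    have := succ_mul_mesh N
    calc (N : ℝ) * (l * mesh N) ^ 2 ≤ ((N : ℝ) + 1) * (l * mesh N) ^ 2 := by gcongr; linarith
      _ = (((N : ℝ) + 1) * mesh N) * (l ^ 2 * mesh N) := by ring
      _ = _ := by rw [this, one_mul]
  have h0 := Finset.sum_nonneg (s := Finset.range N) fun J _ =>
    sq_nonneg (freq n (tailSet (mesh N) β J) x - π.real (tailSet (mesh N) β J))
  calc _ ≤ (l ^ 2 * mesh N) * (V * (N + 1)) :=
        mul_le_mul (h3.trans h4) htail h0 (by positivity)
    _ = l ^ 2 * V * (((N : ℝ) + 1) * mesh N) := by ring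
    _ = _ := by rw [succ_mul_mesh, mul_one]

/-! ### The bias part on a sample with regular relative frequencies -/

theorem mean_sq_le_of_freq_le {d n N : ℕ} {x : ℕ → Fin d → ℝ} (hx : InCube n x) (β : Fin d)
    (w : ℕ → ℝ) {b : ℝ}
    (hb : ∀ J ∈ Finset.range (N + 1), freq n (gramCell N ((β, β), (J, J))) x ≤ b) :
    (n : ℝ)⁻¹ * ∑ i ∈ Finset.range n, w (gridIdx (mesh N) (x i β)) ^ 2 ≤
      b * ∑ J ∈ Finset.range (N + 1), w J ^ 2 := by
  have h1 : ∀ i ∈ Finset.range n, w (gridIdx (mesh N) (x i β)) ^ 2 =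
      ∑ J ∈ Finset.range (N + 1), w J ^ 2 *
        (gramCell N ((β, β), (J, J))).indicator (fun _ => (1 : ℝ)) (x i) := by
    intro i hi
    have h := hx i (Finset.mem_range.1 hi) β
    rw [Finset.sum_eq_single (gridIdx (mesh N) (x i β))]
    · have hmem : x i ∈ gramCell N ((β, β),
          (gridIdx (mesh N) (x i β), gridIdx (mesh N) (x i β))) := ⟨rfl, rfl⟩
      rw [Set.indicator_of_mem hmem, mul_one]
    · intro J _ hJ
      rw [Set.indicator_of_notMem, mul_zero]
      exact fun h => hJ h.1.symm
    · intro h'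
      exact absurd (Finset.mem_range.2 (gridIdx_mesh_lt h.1 h.2)) h'
  rw [Finset.sum_congr rfl h1, mean_sum_indicator, Finset.mul_sum]
  refine Finset.sum_le_sum fun J hJ => ?_
  rw [mul_comm b]
  exact mul_le_mul_of_nonneg_left (hb J hJ) (sq_nonneg _)

theorem sq_mean_le_mean_sq (n : ℕ) (y : ℕ → ℝ) :
    ((n : ℝ)⁻¹ * ∑ i ∈ Finset.range n, y i) ^ 2 ≤ (n : ℝ)⁻¹ * ∑ i ∈ Finset.range n, y i ^ 2 := by
  rcases Nat.eq_zero_or_pos n with rfl | hn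
  · simp
  have h := sq_sum_le_card_mul_sum_sq (s := Finset.range n) (f := y)
  rw [Finset.card_range] at h
  have hn' : (0 : ℝ) < n := by exact_mod_cast hn
  calc _ = ((n : ℝ)⁻¹) ^ 2 * (∑ i ∈ Finset.range n, y i) ^ 2 := mul_pow _ _ _
    _ ≤ ((n : ℝ)⁻¹) ^ 2 * (n * ∑ i ∈ Finset.range n, y i ^ 2) := by gcongr
    _ = _ := by field_simp

theorem freq_le_of_sum_sq_le {d n N : ℕ} {x : ℕ → Fin d → ℝ}
    {p : (Fin d × Fin d) × (ℕ × ℕ) → ℝ} {b e : ℝ} (he : 0 ≤ e)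
    (hgram : ∑ q ∈ gramIdx d N, (freq n (gramCell N q) x - p q) ^ 2 ≤ e ^ 2) (β : Fin d)
    (hp : ∀ J, p ((β, β), (J, J)) ≤ b) :
    ∀ J ∈ Finset.range (N + 1), freq n (gramCell N ((β, β), (J, J))) x ≤ b + e := by
  intro J hJ
  have hq : ((β, β), (J, J)) ∈ gramIdx d N := by
    simp only [gramIdx, Finset.mem_product, Finset.mem_univ, true_and]
    exact ⟨hJ, hJ⟩
  have h1 := (Finset.single_le_sum (f := fun q => (freq n (gramCell N q) x - p q) ^ 2)
    (fun _ _ => sq_nonneg _) hq).trans hgram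
  have h2 := abs_le_of_sq_le_sq h1 he
  have h3 := le_abs_self (freq n (gramCell N ((β, β), (J, J))) x - p ((β, β), (J, J)))
  linarith [hp J]

/-- Grouping the sample by spline cell, Cauchy–Schwarz is used twice: against w, where both factors
are of order √H, and against the constant 1 over N + 1 cells, which shows that the total kernel
weight is bounded. -/
theorem abs_kernel_mean_le {d : ℕ} [NeZero d] {K : ℝ → ℝ} (hK0 : ∀ u, 0 ≤ K u)
    {h : ℝ} (hh : 0 < h) {N n : ℕ} {x : ℕ → Fin d → ℝ} (hx : InCube n x) (β : Fin d) {t A Q D : ℝ}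
    (hA : ∑ J ∈ Finset.range (N + 1), kernelMass K h N n x β t J ^ 2 ≤ A * mesh N)
    {w : ℕ → ℝ} (hw : ∑ J ∈ Finset.range (N + 1), w J ^ 2 ≤ Q * mesh N) (hD : 0 ≤ D)
    {r : ℕ → ℝ} (hr : ∀ i < n, |r i| ≤ |w (gridIdx (mesh N) (x i β))| + D) :
    |(n : ℝ)⁻¹ * ∑ i ∈ Finset.range n, scaledKernel K h (x i 0 - t) * r i| ≤
      Real.sqrt A * Real.sqrt Q * mesh N + Real.sqrt A * D := by
  have hH := mesh_pos N
  set T : ℕ → ℝ := kernelMass K h N n x β t with hT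
  have hKh : ∀ u, 0 ≤ scaledKernel K h u := fun u => div_nonneg (hK0 _) hh.le
  have h1 : |(n : ℝ)⁻¹ * ∑ i ∈ Finset.range n, scaledKernel K h (x i 0 - t) * r i| ≤
      ∑ J ∈ Finset.range (N + 1), T J * (|w J| + D) := by
    rw [hT, ← mean_kernel_mul_eq K h hx β t (fun J => |w J| + D), abs_mul,
      abs_of_nonneg (by positivity : (0 : ℝ) ≤ (n : ℝ)⁻¹)]
    refine mul_le_mul_of_nonneg_left ((Finset.abs_sum_le_sum_abs _ _).trans
      (Finset.sum_le_sum fun i hi => ?_)) (by positivity)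
    rw [abs_mul, abs_of_nonneg (hKh _)]
    exact mul_le_mul_of_nonneg_left (hr i (Finset.mem_range.1 hi)) (hKh _)
  have hA0 : 0 ≤ A := by
    have := (Finset.sum_nonneg fun J (_ : J ∈ Finset.range (N + 1)) => sq_nonneg (T J)).trans hA
    exact nonneg_of_mul_nonneg_left this hH
  have hQ0 : 0 ≤ Q := by
    have := (Finset.sum_nonneg fun J (_ : J ∈ Finset.range (N + 1)) => sq_nonneg (w J)).trans hw
    exact nonneg_of_mul_nonneg_left this hH
  have h2 : ∑ J ∈ Finset.range (N + 1), T J * |w J| ≤ Real.sqrt A * Real.sqrt Q * mesh N := by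
    refine abs_le_of_sq_le_sq' (a := _) ?_ (by positivity) |>.2
    refine (Finset.sum_mul_sq_le_sq_mul_sq _ _ _).trans ?_
    simp only [sq_abs]
    rw [mul_pow, mul_pow, Real.sq_sqrt hA0, Real.sq_sqrt hQ0]
    calc _ ≤ (A * mesh N) * (Q * mesh N) := mul_le_mul hA hw
          (Finset.sum_nonneg fun _ _ => sq_nonneg _) (by positivity)
      _ = _ := by ring
  have h3 : ∑ J ∈ Finset.range (N + 1), T J ≤ Real.sqrt A := by
    refine abs_le_of_sq_le_sq' (a := _) ?_ (by positivity) |>.2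
    rw [Real.sq_sqrt hA0]
    refine sq_sum_le_card_mul_sum_sq.trans ?_
    rw [Finset.card_range]
    push_cast
    calc ((N : ℝ) + 1) * ∑ J ∈ Finset.range (N + 1), T J ^ 2 ≤ ((N : ℝ) + 1) * (A * mesh N) := by
          gcongr
      _ = A * (((N : ℝ) + 1) * mesh N) := by ring
      _ = A := by rw [succ_mul_mesh, mul_one]
  refine h1.trans ?_
  simp only [mul_add, Finset.sum_add_distrib, ← Finset.sum_mul]
  exact add_le_add h2 (mul_le_mul_of_nonneg_right h3 hD)

/-- The uniform bound on the bias part. -/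
theorem abs_biasPart_le {d : ℕ} [NeZero d] {μ : Fin d → Measure ℝ} [∀ α, IsFiniteMeasure (μ α)]
    {π : Measure (Fin d → ℝ)} [IsProbabilityMeasure π]
    (hπ : ∀ᵐ x ∂π, ∀ α, 0 ≤ x α ∧ x α < 1) {c C : ℝ} (hc : 0 < c) (hcC : c ≤ C)
    (hμ : ∀ α, ENNReal.ofReal c • unitMeasure ≤ μ α) {n N L : ℕ} (hn : 0 < n)
    (hlow : ∀ w : Fin d → ℕ → ℝ, (∀ α, α ≠ 0 → ∑ J ∈ Finset.range (N + 1), w α J = 0) →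
      c * mesh N * sqLen N w ≤ ∫ x, (∑ α, w α (gridIdx (mesh N) (x α))) ^ 2 ∂π)
    {x : ℕ → Fin d → ℝ} (hx : InCube n x) {c₀ : ℝ} {m : Fin d → ℝ → ℝ} {l : ℝ} (hl : 0 ≤ l)
    (hm : ∀ α, ∀ s ∈ Set.Icc (0 : ℝ) 1, ∀ t ∈ Set.Icc (0 : ℝ) 1, |m α s - m α t| ≤ l * |s - t|)
    {a : SplineCoeff d N} (ha : IsLeastSquares μ n x (fun i => additiveMean c₀ m (x i)) a)
    {K : ℝ → ℝ} {M : ℝ} (hK0 : ∀ u, 0 ≤ K u) (hKM : ∀ u, K u ≤ M) (hKs : ∀ u, 1 < |u| → K u = 0)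
    {h : ℝ} (hh : 0 < h) (hL : gridIdx h 1 + 2 ≤ L) {β : Fin d}
    (hdiag : ∀ q, π.real (cell (mesh N) (mesh N) β β q) ≤ C * mesh N)
    (hoff : ∀ q, π.real (cell h (mesh N) 0 β q) ≤ C * (h * mesh N))
    (hmean : |∫ y, m β (gridIdx (mesh N) (y β) * mesh N) ∂π| ≤ l * mesh N)
    (hgram : ∑ q ∈ gramIdx d N, (freq n (gramCell N q) x - π.real (gramCell N q)) ^ 2 ≤
      (c * mesh N / 2) ^ 2)
    (hfreq : ∑ q ∈ Finset.range L ×ˢ Finset.range (N + 1),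
      (freq n (cell h (mesh N) 0 β q) x - π.real (cell h (mesh N) 0 β q)) ^ 2 ≤ h ^ 2 * mesh N)
    {V : ℝ} (htail : ∑ J ∈ Finset.range N,
      (freq n (tailSet (mesh N) β J) x - π.real (tailSet (mesh N) β J)) ^ 2 ≤ V * (N + 1))
    {t : ℝ} (ht : t ∈ Set.Icc (0 : ℝ) 1) :
    |biasPart K h m μ n x a β t| ≤
      Real.sqrt (6 * M ^ 2 * (3 * C ^ 2 + 1)) * Real.sqrt (8 * (d * l) ^ 2 / c) * mesh N +
      Real.sqrt (6 * M ^ 2 * (3 * C ^ 2 + 1)) *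
        ((2 * l + Real.sqrt (2 * C * (8 * (d * l) ^ 2 / c))) * mesh N + l * Real.sqrt V) := by
  have hH := mesh_pos N
  have hn' : (0 : ℝ) < n := by exact_mod_cast hn
  set Q := 8 * (d * l) ^ 2 / c with hQ
  have hQ0 : 0 ≤ Q := by positivity
  have hC : 0 < C := hc.trans_le hcC
  obtain ⟨w, hw0, hwsum, hwκ⟩ := exists_centered N (a.1 - c₀)
    (fun α J => splineComponent μ a α (J * mesh N) - m α (J * mesh N))
  obtain ⟨κ, hκ⟩ := hwκ β
  have hfit := mean_fit_sub_sq_le hc hμ hn hx hl hm ha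
  have hge := mean_additive_sq_ge hx (w := w) (b := c * mesh N) (by positivity)
    (by rw [← integral_additive_sq_eq π hπ N w]; exact hlow w hw0) hgram
  have hlen : sqLen N w ≤ Q * mesh N := by
    have e : ∀ i, ∑ α, w α (gridIdx (mesh N) (x i α)) = a.1 - c₀ + ∑ α,
      (splineComponent μ a α (gridIdx (mesh N) (x i α) * mesh N) -
        m α (gridIdx (mesh N) (x i α) * mesh N)) := fun i => (hwsum fun α => _).symm
    simp only [← e] at hfit
    have := hge.trans hfit
    -- From (c H / 2) |w|² ≤ 4 (d l H)² one gets |w|² ≤ Q H; this is where Q = 8 (d l)² / c comes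
    -- from.
    have h2 : c * mesh N / 2 * sqLen N w ≤ c * mesh N / 2 * (Q * mesh N) := by
      refine this.trans (le_of_eq ?_)
      rw [hQ]; field_simp; ring
    exact le_of_mul_le_mul_left h2 (by positivity)
  have hwβ := (sum_sq_le_sqLen N w β).trans hlen
  have hA := sum_kernelMass_sq_le hK0 hKM hKs hh hx β (fun q => measureReal_nonneg) hoff hL hfreq
    ht.1 ht.2
  -- the empirical mean of the centered component
  have hmw : |(n : ℝ)⁻¹ * ∑ i ∈ Finset.range n, w β (gridIdx (mesh N) (x i β))| ≤
      Real.sqrt (2 * C * Q) * mesh N := by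
    refine abs_le_of_sq_le_sq ?_ (by positivity)
    refine (sq_mean_le_mean_sq n _).trans ?_
    have hfr := freq_le_of_sum_sq_le (by positivity) hgram β (fun J => hdiag (J, J))
    refine (mean_sq_le_of_freq_le hx β (w β) hfr).trans ?_
    rw [mul_pow, Real.sq_sqrt (by positivity)]
    calc (C * mesh N + c * mesh N / 2) * ∑ J ∈ Finset.range (N + 1), w β J ^ 2
        ≤ (2 * C * mesh N) * (Q * mesh N) :=
          mul_le_mul (by nlinarith) hwβ (Finset.sum_nonneg fun _ _ => sq_nonneg _) (by positivity)
      _ = _ := by ring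
  -- the empirical mean of the step approximation
  have hmg : |(n : ℝ)⁻¹ * ∑ i ∈ Finset.range n, m β (gridIdx (mesh N) (x i β) * mesh N)| ≤
      l * mesh N + l * Real.sqrt V := by
    have hinc : ∀ J < N, |m β ((J + 1 : ℕ) * mesh N) - m β (J * mesh N)| ≤ l * mesh N := by
      intro J hJ
      have hJ1 : ((J : ℝ) + 1) ≤ N + 1 := by
        have : (J : ℝ) ≤ N := by exact_mod_cast hJ.le
        linarith
      have h1 : ((J : ℝ) + 1) * mesh N ≤ 1 :=
        (mul_le_mul_of_nonneg_right hJ1 hH.le).trans (succ_mul_mesh N).le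
      have h0 : 0 ≤ (J : ℝ) * mesh N := by positivity
      refine (hm β _ ⟨by positivity, by push_cast; exact h1⟩ _
        ⟨h0, by nlinarith⟩).trans (le_of_eq ?_)
      push_cast
      rw [show ((J : ℝ) + 1) * mesh N - J * mesh N = mesh N by ring, abs_of_pos hH]
    have hs := mean_sub_integral_sq_le π hπ hn hx β (g := fun J => m β (J * mesh N)) hinc htail
    have hs' := Real.abs_le_sqrt hs
    rw [Real.sqrt_mul (sq_nonneg l), Real.sqrt_sq hl] at hs'
    have h1 := abs_sub_abs_le_abs_sub
      ((n : ℝ)⁻¹ * ∑ i ∈ Finset.range n, m β (gridIdx (mesh N) (x i β) * mesh N))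
      (∫ y, m β (gridIdx (mesh N) (y β) * mesh N) ∂π)
    linarith
  -- One l H is the distance of m β from its step approximation, the other the expectation of that
  -- approximation; the root term bounds the mean of w, and l √V the sampling fluctuation.
  set D := (2 * l + Real.sqrt (2 * C * Q)) * mesh N + l * Real.sqrt V with hD
  have hD0 : 0 ≤ D := by positivity
  unfold biasPart
  refine abs_kernel_mean_le hK0 hh hx β hA hwβ hD0 fun i hi => ?_
  have hxi := hx i hi β
  have hcomp : ∀ j < n, splineComponent μ a β (x j β) =
      w β (gridIdx (mesh N) (x j β)) + m β (gridIdx (mesh N) (x j β) * mesh N) + κ := by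
    intro j hj
    rw [splineComponent_node μ a β (hx j hj β).1]
    linarith [hκ (gridIdx (mesh N) (x j β))]
  -- The unknown constant κ cancels through the empirical centering.
  have e : pilotComponent μ n x a β (x i β) - m β (x i β) =
      w β (gridIdx (mesh N) (x i β)) + (m β (gridIdx (mesh N) (x i β) * mesh N) - m β (x i β)) -
      (n : ℝ)⁻¹ * ∑ j ∈ Finset.range n, w β (gridIdx (mesh N) (x j β)) -
      (n : ℝ)⁻¹ * ∑ j ∈ Finset.range n, m β (gridIdx (mesh N) (x j β) * mesh N) := by
    rw [pilotComponent, hcomp i hi, Finset.sum_congr rfl fun j hj => hcomp j (Finset.mem_range.1 hj),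
      Finset.sum_add_distrib, Finset.sum_add_distrib]
    simp only [Finset.sum_const, Finset.card_range, nsmul_eq_mul]
    field_simp
    ring
  have hlip : |m β (gridIdx (mesh N) (x i β) * mesh N) - m β (x i β)| ≤ l * mesh N :=
    (hm β _ (node_mem hxi.1 hxi.2) _ ⟨hxi.1, hxi.2.le⟩).trans
      (mul_le_mul_of_nonneg_left (node_dist_le hxi.1) hl)
  rw [e]
  refine (abs_sub _ _).trans ?_
  refine (add_le_add_left (abs_sub _ _) _).trans ?_
  refine (add_le_add_left (add_le_add_left (abs_add_le _ _) _) _).trans ?_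
  rw [hD]
  linarith

/-! ### Rates -/

theorem tendsto_natCast_rpow_neg {y : ℝ} (hy : 0 < y) :
    Tendsto (fun n : ℕ => (n : ℝ) ^ (-y)) atTop (𝓝 0) :=
  (tendsto_rpow_neg_atTop hy).comp tendsto_natCast_atTop_atTop

theorem tendsto_natCast_rpow {y : ℝ} (hy : 0 < y) :
    Tendsto (fun n : ℕ => (n : ℝ) ^ y) atTop atTop :=
  (tendsto_rpow_atTop hy).comp tendsto_natCast_atTop_atTop

theorem tendsto_log_natCast : Tendsto (fun n : ℕ => Real.log n) atTop atTop :=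
  Real.tendsto_log_atTop.comp tendsto_natCast_atTop_atTop

/-- The extra 1/100 over 2/5 absorbs the logarithm, and twice the exponent, 0.82, stays below 9/10.
-/
theorem KnotOrder.eventually_le {N : ℕ → ℕ} (hN : KnotOrder N) :
    ∀ᶠ n : ℕ in atTop, (N n : ℝ) + 1 ≤ (n : ℝ) ^ (41 / 100 : ℝ) := by
  obtain ⟨c, C, hc, hC, hev⟩ := hN
  have hlog := ((isLittleO_log_rpow_atTop (by norm_num : (0 : ℝ) < 1 / 100)).comp_tendsto
    tendsto_natCast_atTop_atTop).bound (by positivity : (0 : ℝ) < 1 / (2 * C))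
  have hbig := (tendsto_natCast_rpow (by norm_num : (0 : ℝ) < 41 / 100)).eventually_ge_atTop 2
  filter_upwards [hev, hlog, hbig, eventually_ge_atTop 1] with n h1 h2 h3 h4
  have hn : (0 : ℝ) < n := by exact_mod_cast h4
  simp only [Function.comp_apply, Real.norm_eq_abs] at h2
  rw [abs_of_nonneg (Real.log_natCast_nonneg n), abs_of_nonneg (Real.rpow_nonneg hn.le _)] at h2
  have e : (n : ℝ) ^ (41 / 100 : ℝ) = (n : ℝ) ^ (2 / 5 : ℝ) * (n : ℝ) ^ (1 / 100 : ℝ) := by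
    rw [← Real.rpow_add hn]; norm_num
  have h5 : C * ((n : ℝ) ^ (2 / 5 : ℝ) * Real.log n) ≤ (n : ℝ) ^ (41 / 100 : ℝ) / 2 := by
    calc C * ((n : ℝ) ^ (2 / 5 : ℝ) * Real.log n)
        ≤ C * ((n : ℝ) ^ (2 / 5 : ℝ) * (1 / (2 * C) * (n : ℝ) ^ (1 / 100 : ℝ))) := by gcongr
      _ = _ := by rw [e]; field_simp
  linarith [h1.2]

theorem KnotOrder.eventually_ge {N : ℕ → ℕ} (hN : KnotOrder N) :
    ∀ᶠ n : ℕ in atTop, (n : ℝ) ^ (2 / 5 : ℝ) ≤ N n := by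
  obtain ⟨c, C, hc, hC, hev⟩ := hN
  filter_upwards [hev, tendsto_log_natCast.eventually_ge_atTop (1 / c)] with n h1 h2
  refine le_trans ?_ h1.1
  have h3 : 1 ≤ c * Real.log n := by
    rw [div_le_iff₀ hc] at h2; linarith
  have h4 : (0 : ℝ) ≤ (n : ℝ) ^ (2 / 5 : ℝ) := by positivity
  nlinarith

/-- The logarithm in the number of knots is what makes H smaller than n^(-2/5), not merely of that
order. -/
theorem KnotOrder.tendsto_rpow_mul_mesh {N : ℕ → ℕ} (hN : KnotOrder N) :
    Tendsto (fun n : ℕ => (n : ℝ) ^ (2 / 5 : ℝ) * mesh (N n)) atTop (𝓝 0) := by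
  obtain ⟨c, C, hc, hC, hev⟩ := hN
  have hlim : Tendsto (fun n : ℕ => (c * Real.log n)⁻¹) atTop (𝓝 0) :=
    (tendsto_log_natCast.const_mul_atTop hc).inv_tendsto_atTop
  refine tendsto_of_tendsto_of_tendsto_of_le_of_le' tendsto_const_nhds hlim
    (Eventually.of_forall fun n => mul_nonneg (by positivity) (mesh_pos _).le) ?_
  filter_upwards [hev, tendsto_log_natCast.eventually_gt_atTop 0, eventually_ge_atTop 1]
    with n h1 h2 h3
  have hn : (0 : ℝ) < n := by exact_mod_cast h3
  have h4 : 0 < (n : ℝ) ^ (2 / 5 : ℝ) := Real.rpow_pos_of_pos hn _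
  rw [mesh, mul_one_div, div_le_iff₀ (by positivity), inv_mul_eq_div, le_div_iff₀ (by positivity)]
  nlinarith [h1.1]

/-- Exponents: -9/10 + 2 · 41/100 = -8/100. -/
theorem tendsto_gram_rate {N : ℕ → ℕ} (hN : KnotOrder N) {c v : ℝ} (hc : 0 < c) (hv : 0 ≤ v) :
    Tendsto (fun n : ℕ => v * (n : ℝ) ^ (-(9 / 10) : ℝ) / (c * mesh (N n) / 2) ^ 2) atTop (𝓝 0) := by
  have hlim : Tendsto (fun n : ℕ => 4 * v / c ^ 2 * (n : ℝ) ^ (-(8 / 100) : ℝ)) atTop (𝓝 0) := by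
    simpa using (tendsto_natCast_rpow_neg (by norm_num : (0 : ℝ) < 8 / 100)).const_mul
      (4 * v / c ^ 2)
  refine tendsto_of_tendsto_of_tendsto_of_le_of_le' tendsto_const_nhds hlim
    (Eventually.of_forall fun n => by positivity) ?_
  filter_upwards [hN.eventually_le, eventually_ge_atTop 1] with n h1 h3
  have hn : (0 : ℝ) < n := by exact_mod_cast h3
  have e : (n : ℝ) ^ (-(8 / 100) : ℝ) =
      (n : ℝ) ^ (-(9 / 10) : ℝ) * ((n : ℝ) ^ (41 / 100 : ℝ)) ^ 2 := by
    rw [← Real.rpow_natCast, ← Real.rpow_mul hn.le, ← Real.rpow_add hn]; norm_num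
  rw [e, mesh]
  calc v * (n : ℝ) ^ (-(9 / 10) : ℝ) / (c * (1 / ((N n : ℝ) + 1)) / 2) ^ 2
      = 4 * v / c ^ 2 * ((n : ℝ) ^ (-(9 / 10) : ℝ) * ((N n : ℝ) + 1) ^ 2) := by field_simp; norm_num
    _ ≤ _ := by gcongr

/-- Exponents: -9/10 + 41/100 + 2 · 1/5 = -9/100. -/
theorem tendsto_kernel_rate {N : ℕ → ℕ} (hN : KnotOrder N) {h : ℕ → ℝ} (hh : BandwidthOrder h)
    {v : ℝ} (hv : 0 ≤ v) :
    Tendsto (fun n : ℕ => v * (n : ℝ) ^ (-(9 / 10) : ℝ) / (h n ^ 2 * mesh (N n))) atTop (𝓝 0) := by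
  obtain ⟨c, C, hc, hC, hev⟩ := hh
  have hlim : Tendsto (fun n : ℕ => v / c ^ 2 * (n : ℝ) ^ (-(9 / 100) : ℝ)) atTop (𝓝 0) := by
    simpa using (tendsto_natCast_rpow_neg (by norm_num : (0 : ℝ) < 9 / 100)).const_mul (v / c ^ 2)
  refine tendsto_of_tendsto_of_tendsto_of_le_of_le' tendsto_const_nhds hlim
    (Eventually.of_forall fun n => by have := mesh_pos (N n); positivity) ?_
  filter_upwards [hN.eventually_le, hev, eventually_ge_atTop 1] with n h1 h2 h3
  have hn : (0 : ℝ) < n := by exact_mod_cast h3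
  have hp : 0 < c * (n : ℝ) ^ (-(1 / 5) : ℝ) := mul_pos hc (Real.rpow_pos_of_pos hn _)
  have hhpos : 0 < h n := hp.trans_le h2.1
  have e : (n : ℝ) ^ (-(9 / 100) : ℝ) = (n : ℝ) ^ (-(9 / 10) : ℝ) * (n : ℝ) ^ (41 / 100 : ℝ) /
      ((n : ℝ) ^ (-(1 / 5) : ℝ)) ^ 2 := by
    rw [← Real.rpow_natCast, ← Real.rpow_mul hn.le, ← Real.rpow_add hn, ← Real.rpow_sub hn]
    norm_num
  rw [e, mesh]
  calc v * (n : ℝ) ^ (-(9 / 10) : ℝ) / (h n ^ 2 * (1 / ((N n : ℝ) + 1)))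
      = v * ((n : ℝ) ^ (-(9 / 10) : ℝ) * ((N n : ℝ) + 1)) / h n ^ 2 := by field_simp
    _ ≤ v * ((n : ℝ) ^ (-(9 / 10) : ℝ) * (n : ℝ) ^ (41 / 100 : ℝ)) /
        (c * (n : ℝ) ^ (-(1 / 5) : ℝ)) ^ 2 := by gcongr; exact h2.1
    _ = _ := by rw [mul_pow]; field_simp

theorem eventually_sq_le {N : ℕ → ℕ} (hN : KnotOrder N) :
    ∀ᶠ n : ℕ in atTop, ((N n : ℝ) + 1) ^ 2 ≤ n := by
  filter_upwards [hN.eventually_le, eventually_ge_atTop 1] with n h1 h3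
  have hn : (1 : ℝ) ≤ n := by exact_mod_cast h3
  calc ((N n : ℝ) + 1) ^ 2 ≤ ((n : ℝ) ^ (41 / 100 : ℝ)) ^ 2 := by gcongr
    _ = (n : ℝ) ^ (82 / 100 : ℝ) := by
        rw [← Real.rpow_natCast, ← Real.rpow_mul (by positivity)]; norm_num
    _ ≤ (n : ℝ) ^ (1 : ℝ) := Real.rpow_le_rpow_of_exponent_le hn (by norm_num)
    _ = n := Real.rpow_one _

theorem BandwidthOrder.eventually_pos {h : ℕ → ℝ} (hh : BandwidthOrder h) :
    ∀ᶠ n : ℕ in atTop, 0 < h n := by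
  obtain ⟨c, C, hc, hC, hev⟩ := hh
  filter_upwards [hev, eventually_ge_atTop 1] with n h2 h3
  have hn : (0 : ℝ) < n := by exact_mod_cast h3
  exact (mul_pos hc (Real.rpow_pos_of_pos hn _)).trans_le h2.1

/-- About n^(1/5) bandwidth strips cover [0,1], far fewer than N + 1, so one square index range
serves both kinds of cells. -/
theorem eventually_gridIdx_le {N : ℕ → ℕ} (hN : KnotOrder N) {h : ℕ → ℝ}
    (hh : BandwidthOrder h) : ∀ᶠ n : ℕ in atTop, gridIdx (h n) 1 + 2 ≤ N n + 1 := by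
  have hpos := hh.eventually_pos
  obtain ⟨c, C, hc, hC, hev⟩ := hh
  have hbig := (tendsto_natCast_rpow (by norm_num : (0 : ℝ) < 1 / 5)).eventually_ge_atTop
    (1 / c + 1)
  filter_upwards [hN.eventually_ge, hev, hpos, hbig, eventually_ge_atTop 1] with n h1 h2 h3 h4 h5
  have hn : (0 : ℝ) < n := by exact_mod_cast h5
  set y := (n : ℝ) ^ (1 / 5 : ℝ) with hy
  have hc' : 0 < 1 / c := by positivity
  have e1 : (n : ℝ) ^ (2 / 5 : ℝ) = y * y := by rw [hy, ← Real.rpow_add hn]; norm_num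
  have e2 : (n : ℝ) ^ (-(1 / 5) : ℝ) = y⁻¹ := Real.rpow_neg hn.le _
  have hy0 : 0 < y := Real.rpow_pos_of_pos hn _
  have h6 : (gridIdx (h n) 1 : ℝ) ≤ 1 / h n := Nat.floor_le (by positivity)
  have h7 : 1 / h n ≤ 1 / c * y := by
    have := h2.1
    rw [e2] at this
    calc 1 / h n ≤ 1 / (c * y⁻¹) := one_div_le_one_div_of_le (by positivity) this
      _ = _ := by field_simp
  have h8 : (gridIdx (h n) 1 : ℝ) + 1 ≤ N n := by
    refine le_trans ?_ h1
    rw [e1]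
    nlinarith
  have h9 : gridIdx (h n) 1 + 1 ≤ N n := by exact_mod_cast h8
  omega

/-! ### Stochastic orders -/

theorem IsBigOp.isLittleOp {Ω : Type*} [MeasurableSpace Ω] {P : Measure Ω} {W : ℕ → Ω → ℝ}
    {r s : ℕ → ℝ} (hW : IsBigOp P W r) (hs : ∀ᶠ n in atTop, 0 < s n)
    (hrs : Tendsto (fun n => r n / s n) atTop (𝓝 0)) : IsLittleOp P W s := by
  intro δ hδ
  rw [ENNReal.tendsto_nhds_zero]
  intro ε hε
  obtain ⟨ε', hε', hle⟩ : ∃ ε' : ℝ, 0 < ε' ∧ ENNReal.ofReal ε' ≤ ε := by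
    rcases eq_or_ne ε ⊤ with rfl | htop
    · exact ⟨1, one_pos, le_top⟩
    · exact ⟨ε.toReal, ENNReal.toReal_pos hε.ne' htop, (ENNReal.ofReal_toReal htop).le⟩
  obtain ⟨M, hM, hev⟩ := hW ε' hε'
  filter_upwards [hev, hs, hrs.eventually_lt_const (by positivity : 0 < δ / M)] with n h1 h2 h3
  refine (measure_mono fun ω hω => ?_).trans (h1.trans hle)
  rw [Set.mem_ofPred_eq] at hω ⊢
  refine lt_of_le_of_lt ?_ hω
  rw [div_lt_div_iff₀ h2 hM] at h3
  linarith

theorem KnotOrder.tendsto_rate_div {N : ℕ → ℕ} (hN : KnotOrder N) :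
    Tendsto (fun n : ℕ => ((n : ℝ) ^ (-(1 / 2) : ℝ) + mesh (N n)) / (n : ℝ) ^ (-(2 / 5) : ℝ))
      atTop (𝓝 0) := by
  have h := (tendsto_natCast_rpow_neg (by norm_num : (0 : ℝ) < 1 / 10)).add hN.tendsto_rpow_mul_mesh
  rw [add_zero] at h
  refine h.congr' ?_
  filter_upwards [eventually_ge_atTop 1] with n h3
  have hn : (0 : ℝ) < n := by exact_mod_cast h3
  rw [add_div, ← Real.rpow_sub hn, Real.rpow_neg hn.le (2 / 5), div_inv_eq_mul, mul_comm (mesh _)]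
  norm_num

/-! ### Probabilities of irregular samples -/

theorem ComponentSmoothness.exists_lipschitz {d : ℕ} [NeZero d] {m : Fin d → ℝ → ℝ}
    (hm : ComponentSmoothness m) : ∃ l : ℝ, 0 ≤ l ∧ ∀ α, ∀ s ∈ Set.Icc (0 : ℝ) 1,
      ∀ t ∈ Set.Icc (0 : ℝ) 1, |m α s - m α t| ≤ l * |s - t| := by
  obtain ⟨h0, C, hC, hβ⟩ := hm
  obtain ⟨K, hK⟩ := h0.exists_lipschitzOnWith (by norm_num) (convex_Icc 0 1) isCompact_Icc
  refine ⟨max K C, le_max_of_le_right hC.le, fun α s hs t ht => ?_⟩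
  by_cases hα : α = 0
  · subst hα
    have h := hK.dist_le_mul s hs t ht
    rw [Real.dist_eq, Real.dist_eq] at h
    exact h.trans (mul_le_mul_of_nonneg_right (le_max_left _ _) (abs_nonneg _))
  · exact (hβ α hα s hs t ht).trans (mul_le_mul_of_nonneg_right (le_max_right _ _) (abs_nonneg _))

section Irregular

variable {Ω : Type*} [MeasurableSpace Ω] {P : Measure Ω} [IsProbabilityMeasure P] {d : ℕ}
  {X : ℕ → Ω → (Fin d → ℝ)} {c C : ℝ}

/-- The step approximation of a centered Lipschitz component has mean of order `H`. -/
theorem DesignBounds.abs_integral_step_le (hb : DesignBounds P X c C)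
    (hX : ∀ i, Measurable (X i)) {g : ℝ → ℝ} {l : ℝ} (hl : 0 ≤ l)
    (hg : ∀ s ∈ Set.Icc (0 : ℝ) 1, ∀ t ∈ Set.Icc (0 : ℝ) 1, |g s - g t| ≤ l * |s - t|) (β : Fin d)
    (hg0 : ∫ ω, g (X 0 ω β) ∂P = 0) (N : ℕ) :
    |∫ y, g (gridIdx (mesh N) (y β) * mesh N) ∂P.map (X 0)| ≤ l * mesh N := by
  have hmem : ∀ᵐ ω ∂P, 0 ≤ X 0 ω β ∧ X 0 ω β < 1 := by
    filter_upwards [hb.ae_mem hX] with ω h using h 0 β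
  have hbound : ∀ t ∈ Set.Icc (0 : ℝ) 1, |g t| ≤ |g 0| + l := by
    intro t ht
    have h1 := hg t ht 0 ⟨le_rfl, zero_le_one⟩
    have h2 := abs_sub_abs_le_abs_sub (g t) (g 0)
    rw [sub_zero, abs_of_nonneg ht.1] at h1
    nlinarith [ht.2]
  have hXβ : Measurable fun ω => X 0 ω β := (measurable_pi_apply β).comp (hX 0)
  have hcont : ContinuousOn g (Set.Icc 0 1) := by
    refine LipschitzOnWith.continuousOn (K := ⟨l, hl⟩) (LipschitzOnWith.of_dist_le_mul ?_)
    intro s hs t ht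
    rw [Real.dist_eq, Real.dist_eq]
    exact hg s hs t ht
  -- Outside [0,1] nothing is known about g, so its measurability along the predictor comes from
  -- continuity on [0,1] and absolute continuity of the law.
  have hac : P.map (fun ω => X 0 ω β) ≪ volume.restrict (Set.Icc (0 : ℝ) 1) :=
    (Measure.absolutelyContinuous_of_le (hb.marginal_upper β)).trans Measure.smul_absolutelyContinuous
  have hint1 : Integrable (fun ω => g (X 0 ω β)) P := by
    refine Integrable.of_bound (((hcont.aestronglyMeasurable measurableSet_Icc).mono_ac
      hac).comp_measurable hXβ) (|g 0| + l) ?_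
    filter_upwards [hmem] with ω h
    exact hbound _ ⟨h.1, h.2.le⟩
  have hstep : Measurable fun y : Fin d → ℝ => g (gridIdx (mesh N) (y β) * mesh N) :=
    (measurable_from_nat (f := fun J : ℕ => g (J * mesh N))).comp
      ((measurable_gridIdx (mesh N)).comp (measurable_pi_apply β))
  have hint2 : Integrable (fun ω => g (gridIdx (mesh N) (X 0 ω β) * mesh N)) P := by
    refine Integrable.of_bound (hstep.comp (hX 0)).aestronglyMeasurable (|g 0| + l) ?_
    filter_upwards [hmem] with ω h
    exact hbound _ (node_mem h.1 h.2)
  rw [integral_map (hX 0).aemeasurable hstep.aestronglyMeasurable]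
  have e : ∫ ω, g (gridIdx (mesh N) (X 0 ω β) * mesh N) ∂P =
      ∫ ω, (g (gridIdx (mesh N) (X 0 ω β) * mesh N) - g (X 0 ω β)) ∂P := by
    rw [integral_sub hint2 hint1, hg0, sub_zero]
  rw [e]
  have h := norm_integral_le_of_norm_le_const (μ := P)
    (f := fun ω => g (gridIdx (mesh N) (X 0 ω β) * mesh N) - g (X 0 ω β)) (C := l * mesh N) (by
      filter_upwards [hmem] with ω h
      exact (hg _ (node_mem h.1 h.2) _ ⟨h.1, h.2.le⟩).trans
        (mul_le_mul_of_nonneg_left (node_dist_le h.1) hl))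
  simpa using h

/-- The constant in the bound for the mean square error of relative frequencies. -/
def mixConst (K₀ lam : ℝ) : ℝ :=
  4 * (1 + K₀) ^ (1 / 10 : ℝ) * (1 - Real.exp (-lam * (1 / 10)))⁻¹

theorem mixConst_pos {K₀ lam : ℝ} (hK : 0 < K₀) (hl : 0 < lam) : 0 < mixConst K₀ lam := by
  have : Real.exp (-lam * (1 / 10)) < 1 := by rw [Real.exp_lt_one_iff]; linarith
  have : 0 < 1 - Real.exp (-lam * (1 / 10)) := by linarith
  unfold mixConst
  positivity

variable {K₀ lam : ℝ}

/-- With θ = 1/10 the at most n cells cost a factor n^(1/10) over the rate 1 / n. -/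
theorem sum_cell_error_le (hX : ∀ i, Measurable (X i)) (hb : DesignBounds P X c C)
    (hK : 0 < K₀) (hl : 0 < lam) (hdec : EventDecay P X K₀ lam) (δ ε : ℝ) (α β : Fin d) {R n : ℕ}
    (hR : 0 < R) (hn : 0 < n) (hcard : ((R : ℝ)) ^ 2 ≤ n) :
    ∑ q ∈ Finset.range R ×ˢ Finset.range R, ∫ ω, (freq n (cell δ ε α β q) (fun i => X i ω) -
      (P.map (X 0)).real (cell δ ε α β q)) ^ 2 ∂P ≤
        mixConst K₀ lam * (n : ℝ) ^ (-(9 / 10) : ℝ) := by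
  have hn' : (0 : ℝ) < n := by exact_mod_cast hn
  refine (sum_integral_freq_sub_sq_le hX hK hl hdec (θ := 1 / 10) (by norm_num) (by norm_num)
    (Finset.range R ×ˢ Finset.range R) ⟨(0, 0), by simp [hR]⟩ (cell δ ε α β)
    (fun q => (P.map (X 0)).real (cell δ ε α β q)) (fun q _ => measurableSet_cell _ _ _ _ _)
    (disjoint_cell _ _ _ _ _)
    (fun q _ i => hb.prob_eq hX (measurableSet_cell _ _ _ _ _) i) hn).trans ?_
  have e : (n : ℝ) ^ (-(9 / 10) : ℝ) = (n : ℝ) ^ (1 / 10 : ℝ) / n := by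
    rw [show (-(9 / 10) : ℝ) = 1 / 10 - 1 by norm_num, Real.rpow_sub hn', Real.rpow_one]
  have hC := mixConst_pos hK hl
  rw [e, ← mul_div_assoc (mixConst K₀ lam), ← mixConst]
  refine div_le_div_of_nonneg_right (mul_le_mul_of_nonneg_left
    (Real.rpow_le_rpow (Nat.cast_nonneg _) ?_ (by norm_num : (0 : ℝ) ≤ 1 / 10)) hC.le) hn'.le
  rw [Finset.card_product, Finset.card_range]
  push_cast
  rw [← sq]
  exact hcard

theorem measure_kernel_irregular_le (hX : ∀ i, Measurable (X i)) (hb : DesignBounds P X c C)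
    (hK : 0 < K₀) (hl : 0 < lam) (hdec : EventDecay P X K₀ lam) (δ ε : ℝ) (α β : Fin d) {R n : ℕ}
    (hR : 0 < R) (hn : 0 < n) (hcard : ((R : ℝ)) ^ 2 ≤ n) {η : ℝ} (hη : 0 < η) :
    P {ω | η < ∑ q ∈ Finset.range R ×ˢ Finset.range R, (freq n (cell δ ε α β q) (fun i => X i ω) -
      (P.map (X 0)).real (cell δ ε α β q)) ^ 2} ≤
        ENNReal.ofReal (mixConst K₀ lam * (n : ℝ) ^ (-(9 / 10) : ℝ) / η) :=
  measure_sum_freq_sub_sq_gt_le hX _ _ _ (fun _ _ => measurableSet_cell _ _ _ _ _) hη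
    (sum_cell_error_le hX hb hK hl hdec δ ε α β hR hn hcard)

/-- Cells for different coordinate pairs overlap, so the partition bound is applied to each of the
d² blocks. -/
theorem measure_gram_irregular_le (hX : ∀ i, Measurable (X i)) (hb : DesignBounds P X c C)
    (hK : 0 < K₀) (hl : 0 < lam) (hdec : EventDecay P X K₀ lam) {N n : ℕ} (hn : 0 < n)
    (hcard : ((N : ℝ) + 1) ^ 2 ≤ n) {η : ℝ} (hη : 0 < η) :
    P {ω | η < ∑ q ∈ gramIdx d N, (freq n (gramCell N q) (fun i => X i ω) -
      (P.map (X 0)).real (gramCell N q)) ^ 2} ≤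
        ENNReal.ofReal ((d : ℝ) ^ 2 * mixConst K₀ lam * (n : ℝ) ^ (-(9 / 10) : ℝ) / η) := by
  refine measure_sum_freq_sub_sq_gt_le hX _ _ _ (fun _ _ => measurableSet_cell _ _ _ _ _) hη ?_
  rw [gramIdx, Finset.sum_product]
  refine (Finset.sum_le_sum fun r _ => sum_cell_error_le hX hb hK hl hdec (mesh N) (mesh N) r.1 r.2
    (Nat.succ_pos N) hn (by push_cast; exact hcard)).trans (le_of_eq ?_)
  simp
  ring

/-- The tail sets are nested, not disjoint, so each is treated as a family of one set, with error
O(1 / n) and no power of the number of cells. -/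
theorem measure_tail_irregular_le (hX : ∀ i, Measurable (X i)) (hb : DesignBounds P X c C)
    (hK : 0 < K₀) (hl : 0 < lam) (hdec : EventDecay P X K₀ lam) (β : Fin d) {N n : ℕ} (hn : 0 < n)
    {V : ℝ} (hV : 0 < V) :
    P {ω | V / n * (N + 1) < ∑ J ∈ Finset.range N, (freq n (tailSet (mesh N) β J) (fun i => X i ω) -
      (P.map (X 0)).real (tailSet (mesh N) β J)) ^ 2} ≤ ENNReal.ofReal (mixConst K₀ lam / V) := by
  have hn' : (0 : ℝ) < n := by exact_mod_cast hn
  have hC := mixConst_pos hK hl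
  have h1 : ∀ J, ∫ ω, (freq n (tailSet (mesh N) β J) (fun i => X i ω) -
      (P.map (X 0)).real (tailSet (mesh N) β J)) ^ 2 ∂P ≤ mixConst K₀ lam / n := by
    intro J
    have := sum_integral_freq_sub_sq_le hX hK hl hdec (θ := 1 / 10) (by norm_num) (by norm_num)
      {J} (Finset.singleton_nonempty J) (tailSet (mesh N) β)
      (fun J => (P.map (X 0)).real (tailSet (mesh N) β J))
      (fun J _ => measurableSet_tailSet _ _ _) (by simp)
      (fun J _ i => hb.prob_eq hX (measurableSet_tailSet _ _ _) i) hn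
    simpa [mixConst] using this
  refine (measure_sum_freq_sub_sq_gt_le hX (Finset.range N) (tailSet (mesh N) β) _
    (fun _ _ => measurableSet_tailSet _ _ _) (v := (N + 1) * (mixConst K₀ lam / n)) (by positivity)
    ?_).trans (le_of_eq ?_)
  · refine (Finset.sum_le_sum fun J _ => h1 J).trans ?_
    rw [Finset.sum_const, Finset.card_range, nsmul_eq_mul]
    gcongr
    linarith
  · congr 1
    field_simp

end Irregular

/-! ### The order in probability of the bias part -/

theorem isBigOp_iSup_biasPart {Ω : Type*} [MeasurableSpace Ω] {P : Measure Ω}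
    [IsProbabilityMeasure P] {d : ℕ} [NeZero d] {X : ℕ → Ω → (Fin d → ℝ)} {c C K₀ lam : ℝ}
    (hX : ∀ i, Measurable (X i)) (hb : DesignBounds P X c C)
    (hK₀ : 0 < K₀) (hlam : 0 < lam) (hdec : EventDecay P X K₀ lam)
    {c₀ : ℝ} {m : Fin d → ℝ → ℝ} {l : ℝ} (hl : 0 ≤ l)
    (hm : ∀ α, ∀ s ∈ Set.Icc (0 : ℝ) 1, ∀ t ∈ Set.Icc (0 : ℝ) 1, |m α s - m α t| ≤ l * |s - t|)
    {K : ℝ → ℝ} {M : ℝ} (hK0 : ∀ u, 0 ≤ K u) (hKM : ∀ u, K u ≤ M) (hKs : ∀ u, 1 < |u| → K u = 0)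
    {h : ℕ → ℝ} (hh : BandwidthOrder h) {N : ℕ → ℕ} (hN : KnotOrder N)
    {μ : Fin d → Measure ℝ} (hμ : ∀ α, μ α = P.map (fun ω => X 0 ω α))
    {a : (n : ℕ) → Ω → SplineCoeff d (N n)}
    (ha : ∀ n ω, IsLeastSquares μ n (fun i => X i ω) (fun i => additiveMean c₀ m (X i ω)) (a n ω))
    {β : Fin d} (hβ : β ≠ 0) (hcenter : ∫ ω, m β (X 0 ω β) ∂P = 0) :
    IsBigOp P
      (fun n ω => ⨆ t : Set.Icc (0 : ℝ) 1, |biasPart K (h n) m μ n (fun i => X i ω) (a n ω) β t|)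
      (fun n => (n : ℝ) ^ (-(1 / 2) : ℝ) + mesh (N n)) := by
  intro ε hε
  have hprob : IsProbabilityMeasure (P.map (X 0)) :=
    Measure.isProbabilityMeasure_map (hX 0).aemeasurable
  have hfin : ∀ α, IsFiniteMeasure (μ α) := fun α => by rw [hμ]; infer_instance
  have hμc : ∀ α, ENNReal.ofReal c • unitMeasure ≤ μ α := fun α => by
    rw [hμ]; exact hb.marginal_lower α
  have hπ : ∀ᵐ x ∂P.map (X 0), ∀ α, 0 ≤ x α ∧ x α < 1 := by
    have hms : MeasurableSet {x : Fin d → ℝ | ∀ α, 0 ≤ x α ∧ x α < 1} := by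
      refine MeasurableSet.congr (s := ⋂ α, {x : Fin d → ℝ | 0 ≤ x α ∧ x α < 1}) ?_ (by ext; simp)
      exact MeasurableSet.iInter fun α => measurableSet_Ico.preimage (measurable_pi_apply α)
    rw [ae_map_iff (hX 0).aemeasurable hms]
    filter_upwards [hb.ae_mem hX] with ω h using h 0
  have hmix := mixConst_pos hK₀ hlam
  have hc := hb.pos
  -- Chosen so that the tail event gets probability at most ε / 2; only through V does the final
  -- constant depend on ε.
  set V := 2 * mixConst K₀ lam / ε with hV
  have hVpos : 0 < V := by positivity
  set A := 6 * M ^ 2 * (3 * C ^ 2 + 1) with hA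
  set Q := 8 * (d * l) ^ 2 / c with hQ
  -- The coefficients of H and of n^(-1/2) in the deterministic bound; the `+ 1` makes B positive.
  set B := Real.sqrt A * Real.sqrt Q + Real.sqrt A * (2 * l + Real.sqrt (2 * C * Q)) +
    Real.sqrt A * (l * Real.sqrt V) + 1 with hB
  refine ⟨B, by positivity, ?_⟩
  have hr1 := tendsto_gram_rate hN hc
    (by positivity : (0 : ℝ) ≤ (d : ℝ) ^ 2 * mixConst K₀ lam)
  have hr2 := tendsto_kernel_rate hN hh hmix.le
  filter_upwards [hr1.eventually_le_const (by positivity : 0 < ε / 4),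
    hr2.eventually_le_const (by positivity : 0 < ε / 4), hh.eventually_pos, eventually_sq_le hN,
    eventually_gridIdx_le hN hh, eventually_ge_atTop 1] with n h1 h2 hhn hcard hL hn
  have hH := mesh_pos (N n)
  have hn' : (0 : ℝ) < n := by exact_mod_cast hn
  set π := P.map (X 0) with hπdef
  set E₀ := {ω | ¬ ∀ i α, 0 ≤ X i ω α ∧ X i ω α < 1} with hE₀
  set E₁ := {ω | (c * mesh (N n) / 2) ^ 2 < ∑ q ∈ gramIdx d (N n),
    (freq n (gramCell (N n) q) (fun i => X i ω) - π.real (gramCell (N n) q)) ^ 2} with hE₁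
  set E₂ := {ω | h n ^ 2 * mesh (N n) < ∑ q ∈ Finset.range (N n + 1) ×ˢ Finset.range (N n + 1),
    (freq n (cell (h n) (mesh (N n)) 0 β q) (fun i => X i ω) -
      π.real (cell (h n) (mesh (N n)) 0 β q)) ^ 2} with hE₂
  set E₃ := {ω | V / n * (N n + 1) < ∑ J ∈ Finset.range (N n),
    (freq n (tailSet (mesh (N n)) β J) (fun i => X i ω) -
      π.real (tailSet (mesh (N n)) β J)) ^ 2} with hE₃
  -- The coefficients may depend on ω in a nonmeasurable way, so the supremum need not be
  -- measurable; inclusion in four exceptional events and monotonicity of the outer measure suffice.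
  have hsub : {ω | B * ((n : ℝ) ^ (-(1 / 2) : ℝ) + mesh (N n)) <
      |(⨆ t : Set.Icc (0 : ℝ) 1, |biasPart K (h n) m μ n (fun i => X i ω) (a n ω) β t|)|} ⊆
      E₀ ∪ E₁ ∪ E₂ ∪ E₃ := by
    intro ω hω
    by_contra hnot
    simp only [Set.mem_union, not_or, hE₀, hE₁, hE₂, hE₃, Set.mem_ofPred_eq, not_not, not_lt] at hnot
    obtain ⟨⟨⟨g0, g1⟩, g2⟩, g3⟩ := hnot
    rw [Set.mem_ofPred_eq] at hω
    refine absurd hω (not_lt.2 ?_)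
    rw [abs_of_nonneg (Real.iSup_nonneg fun _ => abs_nonneg _)]
    have hrate : (0 : ℝ) ≤ (n : ℝ) ^ (-(1 / 2) : ℝ) := by positivity
    refine Real.iSup_le (fun t => ?_) (by positivity)
    refine (abs_biasPart_le (π := π) (L := N n + 1) hπ hc hb.le hμc hn (fun w hw => ?_)
      (fun i _ => g0 i) hl hm (ha n ω) hK0 hKM hKs hhn hL
      (fun q => hb.diag_cell_le hH β q) (fun q => hb.cell_le hhn hH hβ.symm q)
      (hb.abs_integral_step_le hX hl (hm β) β hcenter (N n)) g1 g2 g3 t.2).trans ?_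
    · rw [mul_assoc]
      exact hb.lower_integral_sq (N n) w hw
    · rw [← hA, ← hQ]
      have e : Real.sqrt (V / n) = Real.sqrt V * (n : ℝ) ^ (-(1 / 2) : ℝ) := by
        rw [Real.sqrt_div hVpos.le, Real.rpow_neg hn'.le, ← Real.sqrt_eq_rpow, div_eq_mul_inv]
      rw [e, hB]
      have p1 : 0 ≤ Real.sqrt A * Real.sqrt Q := by positivity
      have p2 : 0 ≤ Real.sqrt A * (2 * l + Real.sqrt (2 * C * Q)) := by positivity
      have p3 : 0 ≤ Real.sqrt A * (l * Real.sqrt V) := by positivity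
      nlinarith [mul_nonneg p1 hrate, mul_nonneg p2 hrate, mul_nonneg p3 hH.le]
  have m0 : P E₀ = 0 := hb.ae_mem hX
  have m1 : P E₁ ≤ ENNReal.ofReal (ε / 4) :=
    (measure_gram_irregular_le hX hb hK₀ hlam hdec hn hcard (by positivity)).trans
      (ENNReal.ofReal_le_ofReal h1)
  have m2 : P E₂ ≤ ENNReal.ofReal (ε / 4) :=
    (measure_kernel_irregular_le hX hb hK₀ hlam hdec (h n) (mesh (N n)) 0 β (Nat.succ_pos _) hn
      (by push_cast; exact hcard) (by positivity)).trans (ENNReal.ofReal_le_ofReal h2)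
  have m3 : P E₃ ≤ ENNReal.ofReal (ε / 2) := by
    refine (measure_tail_irregular_le hX hb hK₀ hlam hdec β hn hVpos).trans (le_of_eq ?_)
    congr 1
    rw [hV]
    field_simp
  calc _ ≤ P (E₀ ∪ E₁ ∪ E₂ ∪ E₃) := measure_mono hsub
    _ ≤ P E₀ + P E₁ + P E₂ + P E₃ :=
        (measure_union_le _ _).trans (add_le_add_left ((measure_union_le _ _).trans
          (add_le_add_left (measure_union_le _ _) _)) _)
    _ ≤ 0 + ENNReal.ofReal (ε / 4) + ENNReal.ofReal (ε / 4) + ENNReal.ofReal (ε / 2) := by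
        rw [m0]; gcongr
    _ = ENNReal.ofReal ε := by
        rw [zero_add, ← ENNReal.ofReal_add (by positivity) (by positivity),
          ← ENNReal.ofReal_add (by positivity) (by positivity)]
        congr 1
        ring

end SPBK

end

/-- The predictors are `X i`, `i = 0, 1, …`, and the sample of size `n` consists of
`X 0, …, X (n-1)`. The coefficients `a n ω` are those of the noiseless spline fit, that is, any
solution of the least squares problem with responses `m(X_i)`. -/
theorem proposition4p1 {Ω : Type*} [MeasurableSpace Ω] (P : Measure Ω) [IsProbabilityMeasure P]
    {d : ℕ} [NeZero d]
    (X : ℕ → Ω → (Fin d → ℝ)) (noise : ℕ → Ω → ℝ)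
    (hX : ∀ i, Measurable (X i)) (hnoise : ∀ i, Measurable (noise i))
    (c : ℝ) (m : Fin d → ℝ → ℝ)
    (hcenter : ∀ α i, ∫ ω, m α (X i ω α) ∂P = 0)
    (hsmooth : SPBK.ComponentSmoothness m)
    (hmix : SPBK.GeometricallyMixing P (fun i ω => (X i ω, noise i ω)))
    (hdens : SPBK.DesignDensity P X)
    (K : ℝ → ℝ) (hK : SPBK.KernelCondition K)
    (h : ℕ → ℝ) (hh : SPBK.BandwidthOrder h)
    (N : ℕ → ℕ) (hN : SPBK.KnotOrder N)
    (μ : Fin d → Measure ℝ) (hμ : ∀ α, μ α = P.map (fun ω => X 0 ω α))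
    (a : (n : ℕ) → Ω → SPBK.SplineCoeff d (N n))
    (ha : ∀ n ω, SPBK.IsLeastSquares μ n (fun i => X i ω)
      (fun i => SPBK.additiveMean c m (X i ω)) (a n ω))
    (β : Fin d) (hβ : β ≠ 0) :
    SPBK.IsBigOp P
      (fun n ω => ⨆ x₁ : Set.Icc (0 : ℝ) 1,
        |SPBK.biasPart K (h n) m μ n (fun i => X i ω) (a n ω) β x₁|)
      (fun n => (n : ℝ) ^ (-(1 / 2) : ℝ) + SPBK.mesh (N n)) ∧
    SPBK.IsLittleOp P
      (fun n ω => ⨆ x₁ : Set.Icc (0 : ℝ) 1,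
        |SPBK.biasPart K (h n) m μ n (fun i => X i ω) (a n ω) β x₁|)
      (fun n => (n : ℝ) ^ (-(2 / 5) : ℝ)) := by
  obtain ⟨K₀, lam, hK₀, hlam, hdec⟩ := hmix.eventDecay_fst
  obtain ⟨c_f, C_f, hb⟩ := hdens.bounds
  obtain ⟨l, hl, hlip⟩ := hsmooth.exists_lipschitz
  obtain ⟨-, ⟨M, hKM⟩, hK0, -, hKs⟩ := hK
  have hO := SPBK.isBigOp_iSup_biasPart hX hb hK₀ hlam hdec hl hlip hK0 hKM hKs hh hN hμ ha hβ
    (hcenter β 0)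
  refine ⟨hO, hO.isLittleOp ?_ hN.tendsto_rate_div⟩
  filter_upwards [eventually_ge_atTop 1] with n hn
  have hn' : (0 : ℝ) < n := by exact_mod_cast hn
  exact Real.rpow_pos_of_pos hn' _
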